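/- **Setting.** Let $K<n<p$ be integers ($n$ the sample size, $p$ the number of features, $K$ the number of latent factors), let $A\in\mathbb{R}^{p\times K}$ and $\beta\in\mathbb{R}^K$ be deterministic, and let $Z\in\mathbb{R}^K$, $E\in\mathbb{R}^p$, $\varepsilon\in\mathbb{R}$ be independent square-integrable random elements with mean zero, with $\Sigma_Z=\mathrm{Cov}(Z)$, $\Sigma_E=\mathrm{Cov}(E)$, $\sigma_\varepsilon^2=\mathrm{Var}(\varepsilon)$. Let $(Z_i,E_i,\varepsilon_i)$, $i=1,\dots,n$, be i.i.d. copies of $(Z,E,\varepsilon)$ and suppose that the data follow the factor regression model $$X_i=AZ_i+E_i,\qquad y_i=Z_i^\top\beta+\varepsilon_i,\qquad i=1,\dots,n.$$ Let $\mathbf{X}\in\mathbb{R}^{n\times p}$ be the matrix with rows $X_1,\dots,X_n$, let $\mathbf{y}=(y_1,\dots,y_n)^\top$, and let $$\widehat\alpha=\arg\min\Big\{\|\alpha\|:\ \|\mathbf{X}\alpha-\mathbf{y}\|=\min_{u\in\mathbb{R}^p}\|\mathbf{X}u-\mathbf{y}\|\Big\}$$ be the minimum-norm least squares estimator (Euclidean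 norms). Write $\sigma_n(\mathbf{X})$ for the $n$-th largest, i.e. smallest, singular value of $\mathbf{X}$; $\mathrm{r_e}(Q)=\mathrm{tr}(Q)/\|Q\|$ for the effective rank of a positive semi-definite matrix $Q\ne0$, where $\|Q\|$ is the operator norm, and $\mathrm{r_e}(0)=1$; and $\|U\|_{\psi_2}=\inf\{t>0:\ \mathbb{E}\exp(U^2/t^2)\le 2\}$ for the sub-Gaussian norm of a real random variable $U$. **Assumptions.** Let $M>0$. 1. $A$ and $\Sigma_Z$ both have rank $K$. 2. $E=\Sigma_E^{1/2}\tilde E$ almost surely, where the entries of $\tilde E\in\mathbb{R}^p$ are independent with mean zero, unit variance and sub-Gaussian norm at most $M$. 3. $Z=\Sigma_Z^{1/2}\tilde Z$ and $\varepsilon=\sigma_\varepsilon\tilde\varepsilon$ almost surely, where the entries of $\tilde Z\in\mathbb{R}^K$ and the random variable $\tilde\varepsilon\in\mathbb{R}$ have mean zero and sub-Gaussian norm at most $M$. **Proposition.** For every $M>0$ there are constants $C,c,c'>0$, depending only on $M$, such that in the above setting and under the above assumptions, if $\mathrm{r_e}(\Sigma_E)>C\,n$, then $\mathrm{tr}(\Sigma_E)>0$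 and, with probability at least $1-c/n$, $$\sigma_n^2(\mathbf{X})\ \ge\ c'\,\mathrm{tr}(\Sigma_E)\qquad\text{and}\qquad \mathbf{X}\widehat\alpha=\mathbf{y},$$ so that $\sigma_n^2(\mathbf{X})\ge c'\,\mathrm{tr}(\Sigma_E)>0$ and $\widehat\alpha$ interpolates the data. -/

import Mathlib

open MeasureTheory ProbabilityTheory
open scoped ENNReal NNReal

noncomputable section

namespace FactorRegression

/-! ### Matrices, singular values, minimum-norm least squares -/

/-- Euclidean norm of a vector. -/
def euclNorm {d : ℕ} (v : Fin d → ℝ) : ℝ := ‖(WithLp.toLp 2 v : EuclideanSpace ℝ (Fin d))‖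

/-- Operator norm of a square matrix with respect to the Euclidean norm. -/
def opNorm {p : ℕ} (Q : Matrix (Fin p) (Fin p) ℝ) : ℝ :=
  ‖Matrix.toEuclideanCLM (n := Fin p) (𝕜 := ℝ) Q‖

open Classical in
/-- Effective rank `tr Q / ‖Q‖`, with the convention that it is `1` if `Q = 0`. -/
def effRank {p : ℕ} (Q : Matrix (Fin p) (Fin p) ℝ) : ℝ :=
  if Q = 0 then 1 else Q.trace / opNorm Q

/-- The `k`-th largest singular value `σ_k(X)`, `k = 1, 2, …` (Mathlib counts from `0`). -/
def sigma {n p : ℕ} (k : ℕ) (X : Matrix (Fin n) (Fin p) ℝ) : ℝ :=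
  (Matrix.toEuclideanLin X).singularValues (k - 1)

/-- `α` minimizes `u ↦ ‖X u - y‖`. -/
def IsLeastSquares {n p : ℕ} (X : Matrix (Fin n) (Fin p) ℝ) (y : Fin n → ℝ)
    (α : Fin p → ℝ) : Prop :=
  ∀ u : Fin p → ℝ, euclNorm (X.mulVec α - y) ≤ euclNorm (X.mulVec u - y)

/-- `α` has minimal norm among all the minimizers of `u ↦ ‖X u - y‖`. -/
def IsMinNormLeastSquares {n p : ℕ} (X : Matrix (Fin n) (Fin p) ℝ) (y : Fin n → ℝ)
    (α : Fin p → ℝ) : Prop :=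
  IsLeastSquares X y α ∧ ∀ α' : Fin p → ℝ, IsLeastSquares X y α' → euclNorm α ≤ euclNorm α'

theorem exists_isLeastSquares {n p : ℕ} (X : Matrix (Fin n) (Fin p) ℝ) (y : Fin n → ℝ) :
    ∃ α, IsLeastSquares X y α := by
  let f := Matrix.toEuclideanLin X
  obtain ⟨v, hv, hmin⟩ := (LinearMap.range f).exists_norm_eq_iInf_of_complete_subspace
    (Submodule.complete_of_finiteDimensional _) (WithLp.toLp 2 y)
  obtain ⟨a, rfl⟩ := hv
  refine ⟨a.ofLp, fun u => ?_⟩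
  have h : ‖WithLp.toLp 2 y - f a‖ ≤ ‖WithLp.toLp 2 y - f (WithLp.toLp 2 u)‖ := by
    rw [hmin]
    exact ciInf_le (f := fun w : LinearMap.range f => ‖WithLp.toLp 2 y - (w : EuclideanSpace ℝ (Fin n))‖)
      ⟨0, by rintro _ ⟨w, rfl⟩; exact norm_nonneg _⟩ ⟨f (WithLp.toLp 2 u), ⟨_, rfl⟩⟩
  rw [norm_sub_rev, norm_sub_rev (WithLp.toLp 2 y)] at h
  exact h

theorem existsUnique_isMinNormLeastSquares {n p : ℕ} (X : Matrix (Fin n) (Fin p) ℝ)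
    (y : Fin n → ℝ) : ∃! α, IsMinNormLeastSquares X y α := by
  let f := Matrix.toEuclideanLin X
  let Y : EuclideanSpace ℝ (Fin n) := WithLp.toLp 2 y
  let S : Set (EuclideanSpace ℝ (Fin p)) := {a | ∀ u, ‖f a - Y‖ ≤ ‖f u - Y‖}
  have hS : ∀ a : EuclideanSpace ℝ (Fin p), a ∈ S ↔ IsLeastSquares X y a.ofLp := fun a =>
    ⟨fun h u => h (WithLp.toLp 2 u), fun h u => h u.ofLp⟩
  have hne : S.Nonempty := by
    obtain ⟨α, hα⟩ := exists_isLeastSquares X y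
    exact ⟨WithLp.toLp 2 α, (hS _).2 hα⟩
  have hconv : Convex ℝ S := by
    intro a ha b hb s t hs ht hst u
    have e : f (s • a + t • b) - Y = s • (f a - Y) + t • (f b - Y) := by
      have : Y = s • Y + t • Y := by rw [← add_smul, hst, one_smul]
      rw [map_add, map_smul, map_smul, smul_sub, smul_sub]
      nth_rewrite 1 [this]
      abel
    rw [e]
    calc _ ≤ s * ‖f a - Y‖ + t * ‖f b - Y‖ := by
          refine (norm_add_le _ _).trans ?_
          rw [norm_smul, norm_smul, Real.norm_of_nonneg hs, Real.norm_of_nonneg ht]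
      _ ≤ s * ‖f u - Y‖ + t * ‖f u - Y‖ := by
          gcongr
          · exact ha u
          · exact hb u
      _ = ‖f u - Y‖ := by rw [← add_mul, hst, one_mul]
  have hclosed : IsClosed S := by
    have : S = ⋂ u, {a | ‖f a - Y‖ ≤ ‖f u - Y‖} := by ext a; simp [S]
    rw [this]
    refine isClosed_iInter fun u => isClosed_le ?_ continuous_const
    exact ((LinearMap.continuous_of_finiteDimensional f).sub continuous_const).norm
  obtain ⟨a, haS, ha⟩ := exists_norm_eq_iInf_of_complete_convex hne hclosed.isComplete hconv 0
  have hmin : ∀ b ∈ S, ‖a‖ ≤ ‖b‖ := fun b hb => by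
    have h : ‖0 - a‖ ≤ ‖0 - b‖ := by
      rw [ha]
      exact ciInf_le (f := fun w : S => ‖(0 : EuclideanSpace ℝ (Fin p)) - w‖)
        ⟨0, by rintro _ ⟨w, rfl⟩; exact norm_nonneg _⟩ ⟨b, hb⟩
    simpa using h
  refine ⟨a.ofLp, ⟨(hS a).1 haS, fun α' h => hmin (WithLp.toLp 2 α') ((hS _).2 h)⟩, ?_⟩
  rintro β ⟨hβ, hβmin⟩
  let b : EuclideanSpace ℝ (Fin p) := WithLp.toLp 2 β
  have hbS : b ∈ S := (hS b).2 hβ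
  have hba : ‖b‖ ≤ ‖a‖ := hβmin a.ofLp ((hS a).1 haS)
  have hmid := hmin _ (hconv haS hbS (by norm_num : (0 : ℝ) ≤ 1 / 2)
    (by norm_num : (0 : ℝ) ≤ 1 / 2) (by norm_num))
  rw [← smul_add, norm_smul, Real.norm_of_nonneg (by norm_num)] at hmid
  have hpar := parallelogram_law_with_norm ℝ a b
  have h0 : ‖a - b‖ = 0 := by
    nlinarith [norm_nonneg a, norm_nonneg b, norm_nonneg (a - b), norm_nonneg (a + b)]
  have : a = b := sub_eq_zero.1 (norm_eq_zero.1 h0)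
  rw [this]

/-- The minimum-norm least squares estimator
`argmin {‖α‖ : ‖X α - y‖ = min_u ‖X u - y‖}`. -/
def minNormEstimator {n p : ℕ} (X : Matrix (Fin n) (Fin p) ℝ) (y : Fin n → ℝ) : Fin p → ℝ :=
  (existsUnique_isMinNormLeastSquares X y).choose

theorem minNormEstimator_spec {n p : ℕ} (X : Matrix (Fin n) (Fin p) ℝ) (y : Fin n → ℝ) :
    IsMinNormLeastSquares X y (minNormEstimator X y) :=
  (existsUnique_isMinNormLeastSquares X y).choose_spec.1

open scoped MatrixOrder in
/-- The positive semi-definite square root of a positive semi-definite matrix. -/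
def matSqrt {d : ℕ} (Q : Matrix (Fin d) (Fin d) ℝ) : Matrix (Fin d) (Fin d) ℝ := CFC.sqrt Q

/-! ### Random vectors -/

/-- The sub-Gaussian norm `inf {t > 0 : 𝔼 exp (U² / t²) ≤ 2}`, with value `∞` if there is
no such `t`. -/
def psi2Norm {Ω : Type*} [MeasurableSpace Ω] (μ : Measure Ω) (U : Ω → ℝ) : ℝ≥0∞ :=
  ⨅ (t : ℝ≥0) (_ : 0 < t)
    (_ : ∫⁻ ω, ENNReal.ofReal (Real.exp (U ω ^ 2 / (t : ℝ) ^ 2)) ∂μ ≤ 2), (t : ℝ≥0∞)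

/-- The covariance matrix of a random vector. -/
def covMat {Ω : Type*} [MeasurableSpace Ω] {d : ℕ} (μ : Measure Ω) (V : Ω → Fin d → ℝ) :
    Matrix (Fin d) (Fin d) ℝ :=
  Matrix.of fun i j => covariance (fun ω => V ω i) (fun ω => V ω j) μ

/-- The random variables of a factor regression model with sample size `n`, `p` features and
`K` factors: `Z`, `E`, `ε` are the population factor and noises, on `(Ω₀, P₀)`; `Zs i`, `Es i`,
`εs i` are those of the `i`-th observation, on `(Ω, P)`. -/
structure IsFactorModel {n p K : ℕ} {Ω₀ Ω : Type*} [MeasurableSpace Ω₀] [MeasurableSpace Ω]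
    (P₀ : Measure Ω₀) (P : Measure Ω)
    (Z : Ω₀ → Fin K → ℝ) (E : Ω₀ → Fin p → ℝ) (ε : Ω₀ → ℝ)
    (Zs : Fin n → Ω → Fin K → ℝ) (Es : Fin n → Ω → Fin p → ℝ) (εs : Fin n → Ω → ℝ) : Prop where
  memLp_Z : ∀ k, MemLp (fun ω => Z ω k) 2 P₀
  memLp_E : ∀ j, MemLp (fun ω => E ω j) 2 P₀
  memLp_ε : MemLp ε 2 P₀
  mean_Z : ∀ k, ∫ ω, Z ω k ∂P₀ = 0
  mean_E : ∀ j, ∫ ω, E ω j ∂P₀ = 0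
  mean_ε : ∫ ω, ε ω ∂P₀ = 0
  /-- `Z`, `E`, `ε` are independent: `E` of `ε`, and `Z` of the pair `(E, ε)`. -/
  indep_noise : IndepFun E ε P₀
  indep_Z : IndepFun Z (fun ω => (E ω, ε ω)) P₀
  /-- The observations are i.i.d. copies of `(Z, E, ε)`. -/
  copies : ∀ i, IdentDistrib (fun ω => (Zs i ω, Es i ω, εs i ω)) (fun ω => (Z ω, E ω, ε ω)) P P₀
  indep_sample : iIndepFun (fun i ω => (Zs i ω, Es i ω, εs i ω)) P

/-- The `n × p` data matrix with rows `X_i = A Z_i + E_i`. -/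
def dataMatrix {n p K : ℕ} {Ω : Type*} (A : Matrix (Fin p) (Fin K) ℝ)
    (Zs : Fin n → Ω → Fin K → ℝ) (Es : Fin n → Ω → Fin p → ℝ) (ω : Ω) :
    Matrix (Fin n) (Fin p) ℝ :=
  Matrix.of fun i => A.mulVec (Zs i ω) + Es i ω

/-- The response vector with entries `y_i = Z_iᵀ β + ε_i`. -/
def response {n K : ℕ} {Ω : Type*} (β : Fin K → ℝ)
    (Zs : Fin n → Ω → Fin K → ℝ) (εs : Fin n → Ω → ℝ) (ω : Ω) : Fin n → ℝ :=
  fun i => Zs i ω ⬝ᵥ β + εs i ω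

/-- `E = Σ_E^{1/2} Ẽ`, where `Ẽ` has independent entries with zero mean, unit variance and
sub-Gaussian norm at most `M`. -/
def NoiseSubGaussian {p : ℕ} {Ω₀ : Type*} [MeasurableSpace Ω₀] (P₀ : Measure Ω₀)
    (E : Ω₀ → Fin p → ℝ) (M : ℝ) : Prop :=
  ∃ Et : Ω₀ → Fin p → ℝ,
    (∀ᵐ ω ∂P₀, E ω = (matSqrt (covMat P₀ E)).mulVec (Et ω)) ∧
    (∀ j, AEMeasurable (fun ω => Et ω j) P₀) ∧
    iIndepFun (fun j ω => Et ω j) P₀ ∧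
    (∀ j, ∫ ω, Et ω j ∂P₀ = 0) ∧
    (∀ j, variance (fun ω => Et ω j) P₀ = 1) ∧
    (∀ j, psi2Norm P₀ (fun ω => Et ω j) ≤ ENNReal.ofReal M)

/-- `Z = Σ_Z^{1/2} Z̃`, where the entries of `Z̃` have zero mean and sub-Gaussian norm
at most `M`. -/
def FactorSubGaussian {K : ℕ} {Ω₀ : Type*} [MeasurableSpace Ω₀] (P₀ : Measure Ω₀)
    (Z : Ω₀ → Fin K → ℝ) (M : ℝ) : Prop :=
  ∃ Zt : Ω₀ → Fin K → ℝ,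
    (∀ᵐ ω ∂P₀, Z ω = (matSqrt (covMat P₀ Z)).mulVec (Zt ω)) ∧
    (∀ k, AEMeasurable (fun ω => Zt ω k) P₀) ∧
    (∀ k, ∫ ω, Zt ω k ∂P₀ = 0) ∧
    (∀ k, psi2Norm P₀ (fun ω => Zt ω k) ≤ ENNReal.ofReal M)

/-- `ε = σ_ε ε̃`, where `ε̃` has zero mean and sub-Gaussian norm at most `M`. -/
def ResponseNoiseSubGaussian {Ω₀ : Type*} [MeasurableSpace Ω₀] (P₀ : Measure Ω₀)
    (ε : Ω₀ → ℝ) (M : ℝ) : Prop :=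
  ∃ εt : Ω₀ → ℝ,
    (∀ᵐ ω ∂P₀, ε ω = Real.sqrt (variance ε P₀) * εt ω) ∧
    AEMeasurable εt P₀ ∧
    (∫ ω, εt ω ∂P₀ = 0) ∧
    psi2Norm P₀ εt ≤ ENNReal.ofReal M

end FactorRegression

end

/-! Project onto the orthogonal complement of the column space of `A`. For a unit vector `u`, `Xᵀ u
= A (∑ uᵢ Zᵢ) + ∑ uᵢ Eᵢ`, so the projection kills the factor part whatever the `Zᵢ` are, and `‖Xᵀ
u‖` is at least the norm of the projected noise. The projection discards at most `K < n` dimensions,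
hence at most `n ‖Σ_E‖` of the trace; since `tr Σ_E > C n ‖Σ_E‖`, the remaining mass `τ` is at least
`tr Σ_E / 2`.

For fixed `u`, the squared norm of the projected noise is a positive semi-definite quadratic form,
of trace `τ` and norm at most `‖Σ_E‖`, in `n p` independent sub-Gaussian variables. A Hanson-Wright
type bound (`measure_quadratic_notMem_le`) puts it between `τ / 2` and a multiple of `τ`, except
with probability `3 exp (-τ / (4096 s⁴ ‖Σ_E‖))`. Its off-diagonal part is decoupled by random
subsets and compared with a Gaussian form.

Large effective rank makes this exponent a large multiple of `n`, which pays for a union bound over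
an exponentially large net of the sphere. `le_norm_of_sphere_net` passes from the net to the sphere.
A lower bound for `Xᵀ` on the sphere bounds `σ_n(X)` below by a Courant-Fischer argument and makes
`X` surjective, so that least squares has zero residual. -/

namespace FactorRegression

/-! ### Exponential moments of one sub-Gaussian variable -/

/-- The linear term vanishes on integrating a centred variable, so a moment of `exp (x²)` controls
the moment generating function with no constant in front. -/
theorem exp_le_add_exp_sq (x : ℝ) : Real.exp x ≤ x + Real.exp (x ^ 2) := by
  rcases le_total |x| 1 with h | h
  · have h1 := (abs_le.1 (Real.abs_exp_sub_one_sub_id_le h)).2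
    have h2 := Real.add_one_le_exp (x ^ 2)
    linarith
  · rcases le_total 0 x with hx | hx
    · rw [abs_of_nonneg hx] at h
      have : Real.exp x ≤ Real.exp (x ^ 2) := Real.exp_le_exp.2 (by nlinarith)
      linarith
    · rw [abs_of_nonpos hx] at h
      have h1 : Real.exp x ≤ 1 := Real.exp_le_one_iff.2 hx
      have h2 := Real.add_one_le_exp (x ^ 2)
      nlinarith

theorem exp_mul_le_of_le_one {a : ℝ} (ha0 : 0 ≤ a) (ha1 : a ≤ 1) (y : ℝ) :
    Real.exp (a * y) ≤ 1 - a + a * Real.exp y := by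
  have h := convexOn_exp.2 (Set.mem_univ 0) (Set.mem_univ y) (sub_nonneg.2 ha1) ha0 (by ring)
  simpa using h

/-- A centred law on `ℝ` of unit variance with `𝔼 exp (x² / s²) ≤ 2`. -/
structure IsStdSubGaussian (s : ℝ) (ν : Measure ℝ) : Prop where
  mean : ∫ x, x ∂ν = 0
  second : ∫ x, x ^ 2 ∂ν = 1
  integrable_exp : Integrable (fun x => Real.exp (x ^ 2 / s ^ 2)) ν
  integral_exp_le : ∫ x, Real.exp (x ^ 2 / s ^ 2) ∂ν ≤ 2

namespace IsStdSubGaussian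

variable {s : ℝ} {ν : Measure ℝ}

/-- A non-integrable function has Bochner integral `0`, so the value `1` of the second moment forces
integrability. -/
theorem integrable_sq (h : IsStdSubGaussian s ν) : Integrable (fun x : ℝ => x ^ 2) ν := by
  by_contra hc
  have := h.second
  rw [integral_undef hc] at this
  norm_num at this

variable [IsProbabilityMeasure ν]

theorem integrable_id (h : IsStdSubGaussian s ν) : Integrable (fun x : ℝ => x) ν := by
  refine ((integrable_const (1 : ℝ)).add h.integrable_sq).mono' (by fun_prop)
    (Filter.Eventually.of_forall fun x => ?_)
  simp only [Real.norm_eq_abs, Pi.add_apply]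
  rw [← sq_abs]
  nlinarith [sq_nonneg (|x| - 1), abs_nonneg x]

/-- For `s² t² ≤ 1`, centring removes the linear term and convexity trades `exp (t² x²)` for `exp
(x² / s²)`. For larger `t`, AM-GM splits `t x` and the resulting factor `3 / 2` is absorbed by half
of the exponent. -/
theorem exp_mul_le (h : IsStdSubGaussian s ν) (hs : 0 < s) (t : ℝ) :
    Integrable (fun x => Real.exp (t * x)) ν ∧
      ∫ x, Real.exp (t * x) ∂ν ≤ Real.exp (s ^ 2 * t ^ 2) := by
  have key : ∃ g : ℝ → ℝ, Integrable g ν ∧ (∀ x, Real.exp (t * x) ≤ g x) ∧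
      ∫ x, g x ∂ν ≤ Real.exp (s ^ 2 * t ^ 2) := by
    rcases le_total (s ^ 2 * t ^ 2) 1 with ha | ha
    · set a := s ^ 2 * t ^ 2 with hadef
      refine ⟨fun x => t * x + ((1 - a) + a * Real.exp (x ^ 2 / s ^ 2)),
        (h.integrable_id.const_mul t).add
          ((integrable_const _).add (h.integrable_exp.const_mul a)), fun x => ?_, ?_⟩
      · have h1 := exp_le_add_exp_sq (t * x)
        have h2 := exp_mul_le_of_le_one (by positivity : 0 ≤ a) ha (x ^ 2 / s ^ 2)
        have h3 : a * (x ^ 2 / s ^ 2) = (t * x) ^ 2 := by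
          rw [hadef]; field_simp
        rw [h3] at h2
        linarith
      · have hA : Integrable (fun x => (1 - a) + a * Real.exp (x ^ 2 / s ^ 2)) ν :=
          (integrable_const _).add (h.integrable_exp.const_mul a)
        simp only
        rw [integral_add (h.integrable_id.const_mul t) hA,
          integral_add (integrable_const _) (h.integrable_exp.const_mul a),
          integral_const_mul, integral_const_mul, h.mean]
        have h4 := h.integral_exp_le
        have h5 := Real.add_one_le_exp a
        have h6 : 0 ≤ a := by positivity
        simp only [integral_const, probReal_univ, smul_eq_mul]
        nlinarith
    · refine ⟨fun x => Real.exp (s ^ 2 * t ^ 2 / 2) * (1 / 2 + 1 / 2 * Real.exp (x ^ 2 / s ^ 2)),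
        ((integrable_const _).add (h.integrable_exp.const_mul _)).const_mul _, fun x => ?_, ?_⟩
      · have h2 := exp_mul_le_of_le_one (a := 1 / 2) (by norm_num) (by norm_num) (x ^ 2 / s ^ 2)
        have h3 : t * x ≤ s ^ 2 * t ^ 2 / 2 + 1 / 2 * (x ^ 2 / s ^ 2) := by
          have : 0 ≤ (s * t - x / s) ^ 2 := sq_nonneg _
          have e : (s * t - x / s) ^ 2 = s ^ 2 * t ^ 2 - 2 * (t * x) + x ^ 2 / s ^ 2 := by
            field_simp
            ring
          linarith
        calc _ ≤ Real.exp (s ^ 2 * t ^ 2 / 2 + 1 / 2 * (x ^ 2 / s ^ 2)) := Real.exp_le_exp.2 h3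
          _ ≤ _ := by
            rw [Real.exp_add]
            exact mul_le_mul_of_nonneg_left (by linarith) (Real.exp_pos _).le
      · rw [integral_const_mul, integral_add (integrable_const _) (h.integrable_exp.const_mul _),
          integral_const_mul]
        have h4 := h.integral_exp_le
        have h5 := Real.add_one_le_exp (s ^ 2 * t ^ 2 / 2)
        have e : Real.exp (s ^ 2 * t ^ 2)
            = Real.exp (s ^ 2 * t ^ 2 / 2) * Real.exp (s ^ 2 * t ^ 2 / 2) := by
          rw [← Real.exp_add]; ring_nf
        rw [e]
        gcongr
        simp only [integral_const, probReal_univ, smul_eq_mul]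
        linarith
  obtain ⟨g, hg, hle, hint⟩ := key
  have hi : Integrable (fun x => Real.exp (t * x)) ν :=
    hg.mono' (by fun_prop) (Filter.Eventually.of_forall fun x => by
      rw [Real.norm_of_nonneg (Real.exp_pos _).le]; exact hle x)
  exact ⟨hi, (integral_mono hi hg hle).trans hint⟩

theorem lintegral_exp_mul_le (h : IsStdSubGaussian s ν) (hs : 0 < s) (t : ℝ) :
    ∫⁻ x, ENNReal.ofReal (Real.exp (t * x)) ∂ν ≤ ENNReal.ofReal (Real.exp (s ^ 2 * t ^ 2)) := by
  rw [← ofReal_integral_eq_lintegral_ofReal (h.exp_mul_le hs t).1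
    (Filter.Eventually.of_forall fun x => (Real.exp_pos _).le)]
  exact ENNReal.ofReal_le_ofReal (h.exp_mul_le hs t).2

/-- Expand `exp (-y)` to second order at `y = l x²`: the first-order term integrates to `-l` by unit
variance, and the quadratic one is dominated by `s⁴ l² exp (x² / s²)`. No smallness of `l` is needed
for this lower tail. -/
theorem lintegral_exp_neg_sq_le (h : IsStdSubGaussian s ν) (hs : 0 < s) {l : ℝ} (hl : 0 ≤ l) :
    ∫⁻ x, ENNReal.ofReal (Real.exp (-(l * x ^ 2))) ∂ν
      ≤ ENNReal.ofReal (Real.exp (-l + 2 * s ^ 4 * l ^ 2)) := by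
  have hle : ∀ x : ℝ, Real.exp (-(l * x ^ 2))
      ≤ 1 - l * x ^ 2 + s ^ 4 * l ^ 2 * Real.exp (x ^ 2 / s ^ 2) := fun x => by
    have h1 : Real.exp (-(l * x ^ 2)) ≤ 1 - l * x ^ 2 + (l * x ^ 2) ^ 2 / 2 := by
      set y := l * x ^ 2
      have hy : 0 ≤ y := by positivity
      have h2 := Real.quadratic_le_exp_of_nonneg hy
      -- Reduces to `(1 - y + y² / 2) (1 + y + y² / 2) = 1 + y⁴ / 4 ≥ 1`.
      rw [Real.exp_neg, inv_le_comm₀ (Real.exp_pos _) (by nlinarith [sq_nonneg (y - 1)])]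
      refine le_trans ?_ h2
      rw [inv_le_iff_one_le_mul₀ (by nlinarith [sq_nonneg (y - 1)])]
      nlinarith [sq_nonneg (y ^ 2)]
    have h3 : (x ^ 2 / s ^ 2) ^ 2 / 2 ≤ Real.exp (x ^ 2 / s ^ 2) := by
      have := Real.quadratic_le_exp_of_nonneg (by positivity : 0 ≤ x ^ 2 / s ^ 2)
      have : 0 ≤ x ^ 2 / s ^ 2 := by positivity
      linarith
    have h4 : (l * x ^ 2) ^ 2 / 2 = s ^ 4 * l ^ 2 * ((x ^ 2 / s ^ 2) ^ 2 / 2) := by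
      field_simp
    have h5 := mul_le_mul_of_nonneg_left h3 (by positivity : 0 ≤ s ^ 4 * l ^ 2)
    linarith
  have hg : Integrable (fun x => 1 - l * x ^ 2 + s ^ 4 * l ^ 2 * Real.exp (x ^ 2 / s ^ 2)) ν :=
    ((integrable_const _).sub (h.integrable_sq.const_mul l)).add (h.integrable_exp.const_mul _)
  have hi : Integrable (fun x => Real.exp (-(l * x ^ 2))) ν :=
    hg.mono' (by fun_prop) (Filter.Eventually.of_forall fun x => by
      rw [Real.norm_of_nonneg (Real.exp_pos _).le]; exact hle x)
  rw [← ofReal_integral_eq_lintegral_ofReal hi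
    (Filter.Eventually.of_forall fun x => (Real.exp_pos _).le)]
  refine ENNReal.ofReal_le_ofReal ((integral_mono hi hg hle).trans ?_)
  have hA : Integrable (fun x => 1 - l * x ^ 2) ν :=
    (integrable_const _).sub (h.integrable_sq.const_mul l)
  rw [integral_add hA (h.integrable_exp.const_mul _), integral_sub (integrable_const _)
    (h.integrable_sq.const_mul l), integral_const_mul, integral_const_mul, h.second]
  have h6 := Real.add_one_le_exp (-l + 2 * s ^ 4 * l ^ 2)
  have h7 := mul_le_mul_of_nonneg_left h.integral_exp_le (by positivity : 0 ≤ s ^ 4 * l ^ 2)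
  simp only [integral_const, probReal_univ, smul_eq_mul]
  linarith

end IsStdSubGaussian

/-! ### Gaussian squares, product measures and quadratic forms -/

/-- `𝔼 exp (t g²) ≤ exp (2 t)` for a standard Gaussian `g` and `0 ≤ t ≤ 1 / 4`. -/
theorem lintegral_exp_sq_gaussian_le {t : ℝ} (ht0 : 0 ≤ t) (ht : t ≤ 1 / 4) :
    ∫⁻ x, ENNReal.ofReal (Real.exp (t * x ^ 2)) ∂(gaussianReal 0 1)
      ≤ ENNReal.ofReal (Real.exp (2 * t)) := by
  have hb : 0 < 1 / 2 - t := by linarith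
  rw [gaussianReal_of_var_ne_zero _ one_ne_zero,
    lintegral_withDensity_eq_lintegral_mul _ (measurable_gaussianPDF 0 1) (by fun_prop)]
  have e : ∀ x : ℝ, (gaussianPDF 0 1 * fun x => ENNReal.ofReal (Real.exp (t * x ^ 2))) x
      = ENNReal.ofReal ((√(2 * Real.pi))⁻¹ * Real.exp (-(1 / 2 - t) * x ^ 2)) := fun x => by
    rw [Pi.mul_apply, gaussianPDF, gaussianPDFReal, ← ENNReal.ofReal_mul (by positivity), mul_assoc,
      ← Real.exp_add]
    simp only [NNReal.coe_one, mul_one, sub_zero]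
    ring_nf
  simp_rw [e]
  rw [← ofReal_integral_eq_lintegral_ofReal ((integrable_exp_neg_mul_sq hb).const_mul _)
    (Filter.Eventually.of_forall fun x => by positivity), integral_const_mul, integral_gaussian]
  refine ENNReal.ofReal_le_ofReal ?_
  rw [← Real.sqrt_inv, ← Real.sqrt_mul (by positivity), Real.sqrt_le_left (Real.exp_pos _).le,
    ← Real.exp_nat_mul]
  have e2 : (2 * Real.pi)⁻¹ * (Real.pi / (1 / 2 - t)) = (1 - 2 * t)⁻¹ := by
    have : 1 - 2 * t ≠ 0 := by linarith
    field_simp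
  rw [e2, inv_le_iff_one_le_mul₀ (by linarith)]
  -- `(1 - 2 t) (1 + 4 t) = 1 + 2 t (1 - 4 t)`, which is at least `1` because `t ≤ 1 / 4`.
  have h1 := Real.add_one_le_exp (((2 : ℕ) : ℝ) * (2 * t))
  push_cast at h1 ⊢
  nlinarith

open Matrix in
/-- Spectral decomposition of a positive semi-definite real matrix, in coordinates. -/
theorem exists_spectral_decomposition {ι : Type*} [Fintype ι] [DecidableEq ι]
    {B : Matrix ι ι ℝ} (hB : B.PosSemidef) :
    ∃ (b : ι → ℝ) (v : ι → ι → ℝ), (∀ k, 0 ≤ b k) ∧ (∀ k, b k = v k ⬝ᵥ B.mulVec (v k)) ∧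
      (∀ k l, v k ⬝ᵥ v l = if k = l then 1 else 0) ∧
      (∀ x, x ⬝ᵥ B.mulVec x = ∑ k, b k * (v k ⬝ᵥ x) ^ 2) ∧
      (∀ x, B.mulVec x ⬝ᵥ B.mulVec x = ∑ k, b k ^ 2 * (v k ⬝ᵥ x) ^ 2) ∧
      B.trace = ∑ k, b k := by
  have hH := hB.isHermitian
  have hsymm : Bᵀ = B := by simpa [Matrix.IsHermitian] using hH
  let v : ι → ι → ℝ := fun k => (hH.eigenvectorBasis k).ofLp
  have hinner : ∀ (x y : ι → ℝ), x ⬝ᵥ y = ∑ k, (v k ⬝ᵥ x) * (v k ⬝ᵥ y) := fun x y => by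
    have := hH.eigenvectorBasis.sum_inner_mul_inner (WithLp.toLp 2 x) (WithLp.toLp 2 y)
    simp only [EuclideanSpace.inner_eq_star_dotProduct, star_trivial] at this
    rw [dotProduct_comm, ← this]
    refine Finset.sum_congr rfl fun k _ => ?_
    rw [dotProduct_comm y]
  have hvB : ∀ k x, v k ⬝ᵥ B.mulVec x = hH.eigenvalues k * (v k ⬝ᵥ x) := fun k x => by
    rw [dotProduct_mulVec, ← mulVec_transpose, hsymm, hH.mulVec_eigenvectorBasis k,
      smul_dotProduct, smul_eq_mul]
  have horth : ∀ k l, v k ⬝ᵥ v l = if k = l then 1 else 0 := fun k l => by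
    have := orthonormal_iff_ite.1 hH.eigenvectorBasis.orthonormal l k
    simp only [EuclideanSpace.inner_eq_star_dotProduct, star_trivial] at this
    rw [this]
    simp [eq_comm]
  refine ⟨hH.eigenvalues, v, hB.eigenvalues_nonneg, fun k => ?_, horth, fun x => ?_, fun x => ?_,
    ?_⟩
  · rw [hvB, horth]; simp
  · rw [hinner]
    exact Finset.sum_congr rfl fun k _ => by rw [hvB]; ring
  · rw [hinner]
    exact Finset.sum_congr rfl fun k _ => by rw [hvB]; ring
  · simpa using hH.trace_eq_sum_eigenvalues

theorem lintegral_pi_prod {ι : Type*} [Fintype ι] (ν : ι → Measure ℝ)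
    [∀ i, IsProbabilityMeasure (ν i)] (f : ι → ℝ → ℝ≥0∞) (hf : ∀ i, Measurable (f i)) :
    ∫⁻ x, ∏ i, f i (x i) ∂(Measure.pi ν) = ∏ i, ∫⁻ t, f i t ∂(ν i) := by
  have h := lintegral_prod_eq_prod_lintegral_of_indepFun Finset.univ
    (fun i (x : ι → ℝ) => f i (x i)) (iIndepFun_pi (μ := ν) fun i => (hf i).aemeasurable)
    (fun i => (hf i).comp (measurable_pi_apply i))
  rw [h]
  exact Finset.prod_congr rfl fun i _ =>
    (measurePreserving_eval ν i).lintegral_comp (hf i)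

theorem ofReal_exp_sum {ι : Type*} (t : Finset ι) (f : ι → ℝ) :
    ENNReal.ofReal (Real.exp (∑ i ∈ t, f i)) = ∏ i ∈ t, ENNReal.ofReal (Real.exp (f i)) := by
  rw [Real.exp_sum, ENNReal.ofReal_prod_of_nonneg fun i _ => (Real.exp_pos _).le]

/-- Exponential moments of a sum of functions of independent coordinates. -/
theorem lintegral_pi_exp_sum_le {ι : Type*} [Fintype ι] (ν : ι → Measure ℝ)
    [∀ i, IsProbabilityMeasure (ν i)] (f : ι → ℝ → ℝ) (hf : ∀ i, Measurable (f i)) (c : ι → ℝ)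
    (hc : ∀ i, ∫⁻ t, ENNReal.ofReal (Real.exp (f i t)) ∂(ν i) ≤ ENNReal.ofReal (Real.exp (c i))) :
    ∫⁻ x, ENNReal.ofReal (Real.exp (∑ i, f i (x i))) ∂(Measure.pi ν)
      ≤ ENNReal.ofReal (Real.exp (∑ i, c i)) := by
  simp_rw [ofReal_exp_sum]
  rw [lintegral_pi_prod ν (fun i t => ENNReal.ofReal (Real.exp (f i t)))
    fun i => by have := hf i; fun_prop]
  exact Finset.prod_le_prod' fun i _ => hc i

theorem IsStdSubGaussian.lintegral_pi_exp_dotProduct_le {ι : Type*} [Fintype ι] {s : ℝ}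
    (hs : 0 < s) {ν : ι → Measure ℝ} [∀ i, IsProbabilityMeasure (ν i)]
    (h : ∀ i, IsStdSubGaussian s (ν i)) (v : ι → ℝ) :
    ∫⁻ x, ENNReal.ofReal (Real.exp (v ⬝ᵥ x)) ∂(Measure.pi ν)
      ≤ ENNReal.ofReal (Real.exp (s ^ 2 * (v ⬝ᵥ v))) := by
  refine (lintegral_pi_exp_sum_le ν (fun i t => v i * t) (fun i => by fun_prop) _
    fun i => (h i).lintegral_exp_mul_le hs (v i)).trans (le_of_eq ?_)
  simp only [dotProduct, Finset.mul_sum, sq]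

theorem lintegral_exp_mul_gaussian (t : ℝ) :
    ∫⁻ g, ENNReal.ofReal (Real.exp (t * g)) ∂(gaussianReal 0 1)
      = ENNReal.ofReal (Real.exp (t ^ 2 / 2)) := by
  rw [← ofReal_integral_eq_lintegral_ofReal (integrable_exp_mul_gaussianReal t)
    (Filter.Eventually.of_forall fun x => (Real.exp_pos _).le)]
  have := congrFun (mgf_fun_id_gaussianReal (μ := 0) (v := 1)) t
  simp only [mgf] at this
  rw [this]
  simp

/-- Exponential moments of a positive semi-definite quadratic form in a sub-Gaussian vector,
by comparison with a Gaussian one. -/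
theorem lintegral_exp_quadratic_le {α ι κ : Type*} [MeasurableSpace α] [Fintype ι] [Fintype κ]
    [DecidableEq κ] {s : ℝ} (ρ : Measure α) [SFinite ρ] {Y : α → ι → ℝ} (hY : Measurable Y)
    (hsub : ∀ v : ι → ℝ, ∫⁻ a, ENNReal.ofReal (Real.exp (v ⬝ᵥ Y a)) ∂ρ
      ≤ ENNReal.ofReal (Real.exp (s ^ 2 * (v ⬝ᵥ v))))
    (v : κ → ι → ℝ) (hv : ∀ k l, v k ⬝ᵥ v l = if k = l then 1 else 0)
    (c : κ → ℝ) (hc0 : ∀ k, 0 ≤ c k) (hc : ∀ k, s ^ 2 * c k ≤ 1 / 4) :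
    ∫⁻ a, ENNReal.ofReal (Real.exp (∑ k, c k / 2 * (v k ⬝ᵥ Y a) ^ 2)) ∂ρ
      ≤ ENNReal.ofReal (Real.exp (2 * s ^ 2 * ∑ k, c k)) := by
  let γ : κ → Measure ℝ := fun _ => gaussianReal 0 1
  -- Each square is linearized by an auxiliary Gaussian, `exp (c q² / 2) = 𝔼 exp (√c q g)`. After
  -- Fubini the hypothesis applies to the random direction `w g`, whose squared length is `∑ c_k
  -- g_k²` by orthonormality.
  let w : (κ → ℝ) → ι → ℝ := fun g => ∑ k, (√(c k) * g k) • v k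
  have hw : ∀ g y, w g ⬝ᵥ y = ∑ k, √(c k) * (v k ⬝ᵥ y) * g k := fun g y => by
    simp only [w, sum_dotProduct, smul_dotProduct, smul_eq_mul]
    exact Finset.sum_congr rfl fun k _ => by ring
  have hww : ∀ g, w g ⬝ᵥ w g = ∑ k, c k * g k ^ 2 := fun g => by
    rw [hw]
    refine Finset.sum_congr rfl fun k _ => ?_
    rw [dotProduct_comm, hw]
    simp only [hv]
    simp only [mul_ite, mul_one, mul_zero, ite_mul, zero_mul, Finset.sum_ite_eq',
      Finset.mem_univ, if_true]
    have := Real.mul_self_sqrt (hc0 k)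
    linear_combination (g k ^ 2) * this
  have hdot : ∀ y : ι → ℝ, Measurable fun x : ι → ℝ => y ⬝ᵥ x := fun y => by
    unfold dotProduct; fun_prop
  have hmeas : Measurable fun q : α × (κ → ℝ) => ENNReal.ofReal (Real.exp (w q.2 ⬝ᵥ Y q.1)) := by
    simp only [hw]
    refine ENNReal.measurable_ofReal.comp (Real.measurable_exp.comp ?_)
    refine Finset.measurable_sum _ fun k _ => ?_
    have h1 : Measurable fun q : α × (κ → ℝ) => v k ⬝ᵥ Y q.1 :=
      (hdot (v k)).comp (hY.comp measurable_fst)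
    have h2 : Measurable fun q : α × (κ → ℝ) => q.2 k := by fun_prop
    exact (h1.const_mul _).mul h2
  calc _ = ∫⁻ a, ∫⁻ g, ENNReal.ofReal (Real.exp (w g ⬝ᵥ Y a)) ∂(Measure.pi γ) ∂ρ := by
        refine lintegral_congr fun a => ?_
        simp_rw [hw, ofReal_exp_sum]
        rw [lintegral_pi_prod γ
          (fun k t => ENNReal.ofReal (Real.exp (√(c k) * (v k ⬝ᵥ Y a) * t)))
          (fun k => by fun_prop)]
        refine Finset.prod_congr rfl fun k _ => ?_
        rw [lintegral_exp_mul_gaussian, mul_pow, Real.sq_sqrt (hc0 k)]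
        ring_nf
    _ = ∫⁻ g, ∫⁻ a, ENNReal.ofReal (Real.exp (w g ⬝ᵥ Y a)) ∂ρ ∂(Measure.pi γ) :=
        lintegral_lintegral_swap hmeas.aemeasurable
    _ ≤ ∫⁻ g, ENNReal.ofReal (Real.exp (∑ k, s ^ 2 * c k * g k ^ 2)) ∂(Measure.pi γ) := by
        refine lintegral_mono fun g => (hsub (w g)).trans (le_of_eq ?_)
        rw [hww, Finset.mul_sum]
        simp only [mul_assoc]
    _ ≤ _ := by
        refine (lintegral_pi_exp_sum_le γ (fun k t => s ^ 2 * c k * t ^ 2) (fun k => by fun_prop)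
          (fun k => 2 * (s ^ 2 * c k)) fun k => lintegral_exp_sq_gaussian_le
            (mul_nonneg (sq_nonneg s) (hc0 k)) (hc k)).trans (le_of_eq ?_)
        rw [Finset.mul_sum]
        simp only [mul_assoc]

/-! ### Chernoff's bound and decoupling by random subsets -/

/-- Chernoff's bound. -/
theorem measure_le_of_lintegral_exp_le {α : Type*} [MeasurableSpace α] (ρ : Measure α)
    {f : α → ℝ} (hf : Measurable f) {c : ℝ}
    (h : ∫⁻ a, ENNReal.ofReal (Real.exp (f a)) ∂ρ ≤ ENNReal.ofReal (Real.exp c)) (t : ℝ) :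
    ρ {a | t ≤ f a} ≤ ENNReal.ofReal (Real.exp (c - t)) := by
  have h1 := mul_meas_ge_le_lintegral (μ := ρ) (f := fun a => ENNReal.ofReal (Real.exp (f a)))
    (by fun_prop) (ENNReal.ofReal (Real.exp t))
  have e : {a | ENNReal.ofReal (Real.exp t) ≤ ENNReal.ofReal (Real.exp (f a))} = {a | t ≤ f a} := by
    ext a
    simp [ENNReal.ofReal_le_ofReal_iff (Real.exp_pos _).le]
  rw [e] at h1
  calc ρ {a | t ≤ f a}
      = ENNReal.ofReal (Real.exp (-t)) * (ENNReal.ofReal (Real.exp t) * ρ {a | t ≤ f a}) := by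
        rw [← mul_assoc, ← ENNReal.ofReal_mul (Real.exp_pos _).le, ← Real.exp_add]
        simp
    _ ≤ ENNReal.ofReal (Real.exp (-t)) * ENNReal.ofReal (Real.exp c) := by
        gcongr; exact h1.trans h
    _ = _ := by
        rw [← ENNReal.ofReal_mul (Real.exp_pos _).le, ← Real.exp_add]
        ring_nf

/-- Resampling the coordinates outside `I` from an independent copy does not change a product law.
This makes the two blocks of a decoupled form independent. -/
theorem map_piecewise_prod_pi {ι : Type*} [Fintype ι] [DecidableEq ι] (ν : ι → Measure ℝ)
    [∀ i, IsProbabilityMeasure (ν i)] (I : Finset ι) :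
    ((Measure.pi ν).prod (Measure.pi ν)).map (fun q i => if i ∈ I then q.1 i else q.2 i)
      = Measure.pi ν := by
  have hm : Measurable fun (q : (ι → ℝ) × (ι → ℝ)) i => if i ∈ I then q.1 i else q.2 i := by
    refine measurable_pi_lambda _ fun i => ?_
    split_ifs <;> fun_prop
  refine (Measure.pi_eq fun S hS => ?_).symm
  rw [Measure.map_apply hm (MeasurableSet.univ_pi hS)]
  have e : (fun (q : (ι → ℝ) × (ι → ℝ)) i => if i ∈ I then q.1 i else q.2 i) ⁻¹' Set.univ.pi S
      = (Set.univ.pi fun i => if i ∈ I then S i else Set.univ) ×ˢ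
        (Set.univ.pi fun i => if i ∈ I then Set.univ else S i) := by
    ext q
    simp only [Set.mem_preimage, Set.mem_pi, Set.mem_univ, true_imp_iff, Set.mem_prod]
    rw [← forall_and]
    refine forall_congr' fun i => ?_
    split_ifs <;> simp
  rw [e, Measure.prod_prod, Measure.pi_pi, Measure.pi_pi, ← Finset.prod_mul_distrib]
  refine Finset.prod_congr rfl fun i _ => ?_
  split_ifs <;> simp

/-- A uniformly random subset separates a given ordered pair with probability `1 / 4`; the subsets
in question form an interval of the Boolean lattice. -/
theorem four_mul_card_mem_notMem {ι : Type*} [Fintype ι] [DecidableEq ι] {i j : ι} (hij : i ≠ j) :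
    4 * (Finset.univ.filter fun I : Finset ι => i ∈ I ∧ j ∉ I).card = 2 ^ Fintype.card ι := by
  have e : (Finset.univ.filter fun I : Finset ι => i ∈ I ∧ j ∉ I)
      = Finset.Icc {i} ({j}ᶜ : Finset ι) := by
    ext I
    simp only [Finset.mem_filter, Finset.mem_univ, true_and, Finset.mem_Icc,
      Finset.singleton_subset_iff, Finset.subset_compl_singleton]
  have hsub : ({i} : Finset ι) ⊆ {j}ᶜ := by simp [hij.symm]
  have hcard : 2 ≤ Fintype.card ι := by
    rw [← Finset.card_pair hij]; exact Finset.card_le_univ _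
  rw [e, Finset.card_Icc_finset hsub, Finset.card_compl, Finset.card_singleton,
    Finset.card_singleton]
  obtain ⟨m, hm⟩ := Nat.exists_eq_add_of_le hcard
  rw [hm, show 2 + m - 1 - 1 = m by omega, pow_add]
  norm_num

theorem offDiag_eq_average {ι : Type*} [Fintype ι] [DecidableEq ι] (f : ι → ι → ℝ) :
    ∑ i, ∑ j, (if i = j then 0 else f i j)
      = ∑ I : Finset ι, (2 ^ Fintype.card ι : ℝ)⁻¹ *
          (4 * ∑ i, ∑ j, if i ∈ I ∧ j ∉ I then f i j else 0) := by
  simp_rw [Finset.mul_sum]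
  rw [Finset.sum_comm (s := (Finset.univ : Finset (Finset ι)))]
  refine Finset.sum_congr rfl fun i _ => ?_
  rw [Finset.sum_comm]
  refine Finset.sum_congr rfl fun j _ => ?_
  rw [← Finset.mul_sum, ← Finset.mul_sum, ← Finset.sum_filter, Finset.sum_const, nsmul_eq_mul]
  split_ifs with h
  · subst h; simp
  · have h2 : (4 * ((Finset.univ.filter fun I : Finset ι => i ∈ I ∧ j ∉ I).card : ℝ))
      = 2 ^ Fintype.card ι := by exact_mod_cast four_mul_card_mem_notMem h
    rw [← mul_assoc 4, h2, ← mul_assoc, inv_mul_cancel₀ (by positivity), one_mul]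

/-! ### Hanson-Wright type tail bounds -/

section HansonWright

variable {ι : Type*} [Fintype ι] [DecidableEq ι] {s : ℝ} {ν : ι → Measure ℝ}
  [∀ i, IsProbabilityMeasure (ν i)] {B : Matrix ι ι ℝ} {b : ℝ}

/-- For fixed `I` the form is bilinear in two independent blocks. Integrating out the block outside
`I` leaves at most `exp (16 l² s² ‖B Y‖²)`, with `Y` the block in `I`. Gaussian comparison in the
eigenbasis of `B`, where `c_k = 32 l² s² e_k²`, and `∑ e_k² ≤ b tr B` finish; the condition on `l`
is what the comparison requires. -/
theorem lintegral_exp_decoupled_le (hs : 0 < s) (h : ∀ i, IsStdSubGaussian s (ν i))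
    (hB : B.PosSemidef) (hb : ∀ x, x ⬝ᵥ B.mulVec x ≤ b * (x ⬝ᵥ x)) {l : ℝ}
    (hl : 32 * l ^ 2 * s ^ 4 * b ^ 2 ≤ 1 / 4) (I : Finset ι) :
    ∫⁻ x, ENNReal.ofReal (Real.exp
        (-l * (4 * ∑ i, ∑ j, if i ∈ I ∧ j ∉ I then x i * B i j * x j else 0))) ∂(Measure.pi ν)
      ≤ ENNReal.ofReal (Real.exp (64 * l ^ 2 * s ^ 4 * (b * B.trace))) := by
  obtain ⟨e, v, he0, hev, hv, hq, hq2, htr⟩ := exists_spectral_decomposition hB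
  have heb : ∀ k, e k ≤ b := fun k => by
    have := hb (v k)
    rwa [← hev, hv, if_pos rfl, mul_one] at this
  have hsymm : ∀ i j, B i j = B j i := fun i j => by
    simpa using (congrFun (congrFun hB.isHermitian i) j).symm
  let Y : (ι → ℝ) → ι → ℝ := fun x i => if i ∈ I then x i else 0
  let w : (ι → ℝ) → ι → ℝ := fun x j => if j ∈ I then 0 else -4 * l * (B.mulVec (Y x)) j
  have hY : Measurable Y := measurable_pi_lambda _ fun i => by
    simp only [Y]; split_ifs <;> fun_prop
  have hYw : ∀ q : (ι → ℝ) × (ι → ℝ),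
      -l * (4 * ∑ i, ∑ j, if i ∈ I ∧ j ∉ I then (if i ∈ I then q.1 i else q.2 i) * B i j *
        (if j ∈ I then q.1 j else q.2 j) else 0) = w q.1 ⬝ᵥ q.2 := fun q => by
    simp only [dotProduct, w, Y, Matrix.mulVec]
    rw [Finset.sum_comm, Finset.mul_sum, Finset.mul_sum]
    refine Finset.sum_congr rfl fun j _ => ?_
    by_cases hj : j ∈ I
    · simp [hj]
    · simp only [hj, not_false_iff, and_true, if_false]
      rw [Finset.mul_sum, Finset.mul_sum, Finset.mul_sum, Finset.sum_mul]
      refine Finset.sum_congr rfl fun i _ => ?_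
      rw [hsymm j i]
      split_ifs <;> ring
  have hww : ∀ x, s ^ 2 * (w x ⬝ᵥ w x)
      ≤ ∑ k, (32 * l ^ 2 * s ^ 2 * e k ^ 2) / 2 * (v k ⬝ᵥ Y x) ^ 2 := fun x => by
    have h1 : w x ⬝ᵥ w x ≤ 16 * l ^ 2 * (B.mulVec (Y x) ⬝ᵥ B.mulVec (Y x)) := by
      simp only [dotProduct, Finset.mul_sum]
      refine Finset.sum_le_sum fun j _ => ?_
      simp only [w]
      split_ifs
      · have := mul_self_nonneg (B.mulVec (Y x) j)
        have := sq_nonneg l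
        rw [mul_zero]; positivity
      · exact le_of_eq (by ring)
    rw [hq2, Finset.mul_sum] at h1
    refine (mul_le_mul_of_nonneg_left h1 (sq_nonneg s)).trans (le_of_eq ?_)
    rw [Finset.mul_sum]
    exact Finset.sum_congr rfl fun k _ => by ring
  have hmw : Measurable fun q : (ι → ℝ) × (ι → ℝ) => w q.1 ⬝ᵥ q.2 := by
    simp_rw [← hYw]
    refine Measurable.const_mul (Measurable.const_mul ?_ _) _
    refine Finset.measurable_sum _ fun i _ => Finset.measurable_sum _ fun j _ => ?_
    split_ifs <;> fun_prop
  have hmw' : Measurable fun q : (ι → ℝ) × (ι → ℝ) => ENNReal.ofReal (Real.exp (w q.1 ⬝ᵥ q.2)) :=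
    ENNReal.measurable_ofReal.comp (Real.measurable_exp.comp hmw)
  have hlin := IsStdSubGaussian.lintegral_pi_exp_dotProduct_le hs h
  have hsub : ∀ u : ι → ℝ, ∫⁻ x, ENNReal.ofReal (Real.exp (u ⬝ᵥ Y x)) ∂(Measure.pi ν)
      ≤ ENNReal.ofReal (Real.exp (s ^ 2 * (u ⬝ᵥ u))) := fun u => by
    have e1 : ∀ x, u ⬝ᵥ Y x = Y u ⬝ᵥ x := fun x => by
      simp only [dotProduct, Y]
      exact Finset.sum_congr rfl fun i _ => by split_ifs <;> ring
    simp_rw [e1]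
    refine (hlin (Y u)).trans (ENNReal.ofReal_le_ofReal (Real.exp_le_exp.2
      (mul_le_mul_of_nonneg_left (Finset.sum_le_sum fun i _ => ?_) (sq_nonneg s))))
    simp only [Y]
    split_ifs
    · exact le_rfl
    · rw [mul_zero]; exact mul_self_nonneg _
  have hpm : Measurable fun (q : (ι → ℝ) × (ι → ℝ)) i => if i ∈ I then q.1 i else q.2 i :=
    measurable_pi_lambda _ fun i => by split_ifs <;> fun_prop
  have hfm : Measurable fun x : ι → ℝ => ENNReal.ofReal (Real.exp
      (-l * (4 * ∑ i, ∑ j, if i ∈ I ∧ j ∉ I then x i * B i j * x j else 0))) := by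
    refine ENNReal.measurable_ofReal.comp (Real.measurable_exp.comp
      (Measurable.const_mul (Measurable.const_mul ?_ _) _))
    refine Finset.measurable_sum _ fun i _ => Finset.measurable_sum _ fun j _ => ?_
    split_ifs <;> fun_prop
  rw [← map_piecewise_prod_pi ν I, lintegral_map hfm hpm]
  simp_rw [hYw]
  rw [lintegral_prod _ hmw'.aemeasurable]
  calc _ ≤ ∫⁻ x, ENNReal.ofReal (Real.exp
          (∑ k, (32 * l ^ 2 * s ^ 2 * e k ^ 2) / 2 * (v k ⬝ᵥ Y x) ^ 2)) ∂(Measure.pi ν) :=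
        lintegral_mono fun x => (hlin (w x)).trans
          (ENNReal.ofReal_le_ofReal (Real.exp_le_exp.2 (hww x)))
    _ ≤ _ := lintegral_exp_quadratic_le (Measure.pi ν) hY hsub v hv _
          (fun k => by positivity) (fun k => by
            have : e k ^ 2 ≤ b ^ 2 := pow_le_pow_left₀ (he0 k) (heb k) 2
            have := mul_le_mul_of_nonneg_left this (by positivity : 0 ≤ 32 * l ^ 2 * s ^ 4)
            nlinarith)
    _ ≤ _ := by
        refine ENNReal.ofReal_le_ofReal (Real.exp_le_exp.2 ?_)
        have h2 : ∑ k, e k ^ 2 ≤ b * B.trace := by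
          rw [htr, Finset.mul_sum]
          exact Finset.sum_le_sum fun k _ => by
            rw [sq]; exact mul_le_mul_of_nonneg_right (heb k) (he0 k)
        rw [← Finset.mul_sum]
        have := mul_le_mul_of_nonneg_left h2 (by positivity : 0 ≤ 64 * l ^ 2 * s ^ 4)
        nlinarith

/-- The off-diagonal form is an average of decoupled ones, so Jensen's inequality transfers their
common bound. -/
theorem lintegral_exp_offDiag_le (hs : 0 < s) (h : ∀ i, IsStdSubGaussian s (ν i))
    (hB : B.PosSemidef) (hb : ∀ x, x ⬝ᵥ B.mulVec x ≤ b * (x ⬝ᵥ x)) {l : ℝ}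
    (hl : 32 * l ^ 2 * s ^ 4 * b ^ 2 ≤ 1 / 4) :
    ∫⁻ x, ENNReal.ofReal (Real.exp
        (-l * ∑ i, ∑ j, if i = j then 0 else x i * B i j * x j)) ∂(Measure.pi ν)
      ≤ ENNReal.ofReal (Real.exp (64 * l ^ 2 * s ^ 4 * (b * B.trace))) := by
  set N : ℝ := 2 ^ Fintype.card ι with hN
  have hNpos : 0 < N := by positivity
  have hsum : ∑ _I : Finset ι, N⁻¹ = 1 := by
    rw [Finset.sum_const, Finset.card_univ, Fintype.card_finset, nsmul_eq_mul, hN]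
    push_cast
    exact mul_inv_cancel₀ (by positivity)
  have hjensen : ∀ x : ι → ℝ, ENNReal.ofReal (Real.exp
        (-l * ∑ i, ∑ j, if i = j then 0 else x i * B i j * x j))
      ≤ ∑ I : Finset ι, ENNReal.ofReal N⁻¹ * ENNReal.ofReal (Real.exp
        (-l * (4 * ∑ i, ∑ j, if i ∈ I ∧ j ∉ I then x i * B i j * x j else 0))) := fun x => by
    have hJ := convexOn_exp.map_sum_le (t := Finset.univ) (w := fun _ : Finset ι => N⁻¹)
      (p := fun I : Finset ι =>
        -l * (4 * ∑ i, ∑ j, if i ∈ I ∧ j ∉ I then x i * B i j * x j else 0))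
      (fun _ _ => by positivity) hsum (fun _ _ => Set.mem_univ _)
    simp only [smul_eq_mul] at hJ
    have e1 : -l * ∑ i, ∑ j, (if i = j then 0 else x i * B i j * x j)
        = ∑ I : Finset ι, N⁻¹ *
          (-l * (4 * ∑ i, ∑ j, if i ∈ I ∧ j ∉ I then x i * B i j * x j else 0)) := by
      rw [offDiag_eq_average fun i j => x i * B i j * x j, Finset.mul_sum]
      exact Finset.sum_congr rfl fun I _ => by ring
    rw [e1]
    refine (ENNReal.ofReal_le_ofReal hJ).trans (le_of_eq ?_)
    rw [ENNReal.ofReal_sum_of_nonneg fun I _ => by positivity]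
    exact Finset.sum_congr rfl fun I _ => ENNReal.ofReal_mul (by positivity)
  refine (lintegral_mono hjensen).trans ?_
  have hm : ∀ I : Finset ι, Measurable fun x : ι → ℝ => ENNReal.ofReal (Real.exp
      (-l * (4 * ∑ i, ∑ j, if i ∈ I ∧ j ∉ I then x i * B i j * x j else 0))) := fun I => by
    refine ENNReal.measurable_ofReal.comp (Real.measurable_exp.comp
      (Measurable.const_mul (Measurable.const_mul ?_ _) _))
    refine Finset.measurable_sum _ fun i _ => Finset.measurable_sum _ fun j _ => ?_
    split_ifs <;> fun_prop
  rw [lintegral_finsetSum _ fun I _ => (hm I).const_mul _]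
  simp_rw [lintegral_const_mul _ (hm _)]
  refine (Finset.sum_le_sum fun I _ => mul_le_mul_right
    (lintegral_exp_decoupled_le hs h hB hb hl I) _).trans (le_of_eq ?_)
  rw [← Finset.sum_mul, ← ENNReal.ofReal_sum_of_nonneg fun _ _ => by positivity, hsum]
  simp

theorem quadratic_eq_diag_add_offDiag (B : Matrix ι ι ℝ) (x : ι → ℝ) :
    x ⬝ᵥ B.mulVec x
      = ∑ i, B i i * x i ^ 2 + ∑ i, ∑ j, if i = j then 0 else x i * B i j * x j := by
  simp only [dotProduct, Matrix.mulVec]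
  rw [← Finset.sum_add_distrib]
  refine Finset.sum_congr rfl fun i _ => ?_
  rw [Finset.mul_sum, ← Finset.add_sum_erase _ _ (Finset.mem_univ i),
    ← Finset.add_sum_erase (a := i) Finset.univ (fun j => if i = j then 0 else x i * B i j * x j)
      (Finset.mem_univ i)]
  simp only [if_true, zero_add]
  congr 1
  · ring
  · refine Finset.sum_congr rfl fun j hj => ?_
    rw [if_neg (Finset.ne_of_mem_erase hj).symm]
    ring

theorem measure_offDiag_le (hs : 1 ≤ s) (h : ∀ i, IsStdSubGaussian s (ν i))
    (hB : B.PosSemidef) (hb0 : 0 < b) (hb : ∀ x, x ⬝ᵥ B.mulVec x ≤ b * (x ⬝ᵥ x)) :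
    Measure.pi ν {x | ∑ i, ∑ j, (if i = j then 0 else x i * B i j * x j) ≤ -(B.trace / 4)}
      ≤ ENNReal.ofReal (Real.exp (-(B.trace / (4096 * s ^ 4 * b)))) := by
  have hs0 : 0 < s := by linarith
  have hs4 : 1 ≤ s ^ 4 := one_le_pow₀ hs
  -- The minimizer of the Chernoff exponent `64 l² s⁴ b tr B - l tr B / 4`; its minimum value gives
  -- the constant `4096`.
  set l : ℝ := 1 / (512 * s ^ 4 * b) with hl
  have hl0 : 0 < l := by positivity
  have hlb : 32 * l ^ 2 * s ^ 4 * b ^ 2 ≤ 1 / 4 := by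
    have : 32 * l ^ 2 * s ^ 4 * b ^ 2 = 32 / 512 ^ 2 / s ^ 4 := by
      rw [hl]; field_simp
    rw [this, div_le_iff₀ (by positivity)]
    linarith
  have hm : Measurable fun x : ι → ℝ =>
      -l * ∑ i, ∑ j, (if i = j then 0 else x i * B i j * x j) := by
    refine Measurable.const_mul (Finset.measurable_sum _ fun i _ =>
      Finset.measurable_sum _ fun j _ => ?_) _
    split_ifs <;> fun_prop
  refine le_trans (measure_mono fun x hx => ?_) ((measure_le_of_lintegral_exp_le _ hm
    (lintegral_exp_offDiag_le hs0 h hB hb hlb) (l * (B.trace / 4))).trans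
    (ENNReal.ofReal_le_ofReal (Real.exp_le_exp.2 (le_of_eq ?_))))
  · have := mul_le_mul_of_nonneg_left (Set.mem_ofPred_eq ▸ hx) hl0.le
    simp only [Set.mem_ofPred_eq]
    linarith
  · rw [hl]; field_simp; ring

theorem measure_diag_le (hs : 1 ≤ s) (h : ∀ i, IsStdSubGaussian s (ν i))
    (hB : B.PosSemidef) (hb0 : 0 < b) (hb : ∀ x, x ⬝ᵥ B.mulVec x ≤ b * (x ⬝ᵥ x)) :
    Measure.pi ν {x | ∑ i, B i i * x i ^ 2 ≤ 3 / 4 * B.trace}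
      ≤ ENNReal.ofReal (Real.exp (-(B.trace / (4096 * s ^ 4 * b)))) := by
  have hs0 : 0 < s := by linarith
  have hB0 : ∀ i, 0 ≤ B i i := fun i => hB.diag_nonneg
  have hBb : ∀ i, B i i ≤ b := fun i => by
    have := hb (Pi.single i 1)
    simpa using this
  have htr0 : 0 ≤ B.trace := Finset.sum_nonneg fun i _ => hB0 i
  -- The minimizer of `2 s⁴ l² b tr B - l tr B / 4`. The resulting rate is 32 times the stated one,
  -- which is weakened to match the off-diagonal bound.
  set l : ℝ := 1 / (16 * s ^ 4 * b) with hl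
  have hl0 : 0 < l := by positivity
  have hexp := lintegral_pi_exp_sum_le ν (fun i t => -(l * B i i * t ^ 2)) (fun i => by fun_prop) _
    fun i => (h i).lintegral_exp_neg_sq_le hs0 (mul_nonneg hl0.le (hB0 i))
  have hsum : ∑ i, (-(l * B i i) + 2 * s ^ 4 * (l * B i i) ^ 2)
      ≤ -l * B.trace + 2 * s ^ 4 * l ^ 2 * b * B.trace := by
    simp only [Matrix.trace, Matrix.diag, Finset.mul_sum]
    rw [← Finset.sum_add_distrib]
    refine Finset.sum_le_sum fun i _ => ?_
    have := mul_le_mul_of_nonneg_left (mul_le_mul_of_nonneg_right (hBb i) (hB0 i))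
      (by positivity : 0 ≤ 2 * s ^ 4 * l ^ 2)
    nlinarith
  refine le_trans (measure_mono fun x hx => ?_) ((measure_le_of_lintegral_exp_le _ (by fun_prop)
    (hexp.trans (ENNReal.ofReal_le_ofReal (Real.exp_le_exp.2 hsum)))
      (-l * (3 / 4 * B.trace))).trans (ENNReal.ofReal_le_ofReal (Real.exp_le_exp.2 ?_)))
  · have := mul_le_mul_of_nonneg_left (Set.mem_ofPred_eq ▸ hx) hl0.le
    rw [Finset.mul_sum] at this
    simp only [Set.mem_ofPred_eq, Finset.sum_neg_distrib]
    simp only [← mul_assoc] at this ⊢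
    linarith
  · have e : -l * B.trace + 2 * s ^ 4 * l ^ 2 * b * B.trace - -l * (3 / 4 * B.trace)
        = -(32 * (B.trace / (4096 * s ^ 4 * b))) := by
      rw [hl]; field_simp; ring
    rw [e]
    have : 0 ≤ B.trace / (4096 * s ^ 4 * b) := by positivity
    linarith

theorem measure_quadratic_ge_le (hs : 1 ≤ s) (h : ∀ i, IsStdSubGaussian s (ν i))
    (hB : B.PosSemidef) (hb0 : 0 < b) (hb : ∀ x, x ⬝ᵥ B.mulVec x ≤ b * (x ⬝ᵥ x)) :
    Measure.pi ν {x | 8 * s ^ 2 * B.trace ≤ x ⬝ᵥ B.mulVec x}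
      ≤ ENNReal.ofReal (Real.exp (-(B.trace / (4096 * s ^ 4 * b)))) := by
  obtain ⟨e, v, he0, hev, hv, hq, hq2, htr⟩ := exists_spectral_decomposition hB
  have heb : ∀ k, e k ≤ b := fun k => by
    have := hb (v k)
    rwa [← hev, hv, if_pos rfl, mul_one] at this
  have hs0 : 0 < s := by linarith
  have htr0 : 0 ≤ B.trace := htr ▸ Finset.sum_nonneg fun k _ => he0 k
  -- The largest value for which `s² (2 μ e_k) ≤ 1 / 4` follows from `e_k ≤ b`.
  set μ : ℝ := 1 / (8 * s ^ 2 * b) with hμ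
  have hμ0 : 0 < μ := by positivity
  have hexp := lintegral_exp_quadratic_le (Measure.pi ν) (Y := fun x => x) measurable_id
    (IsStdSubGaussian.lintegral_pi_exp_dotProduct_le hs0 h) v hv (fun k => 2 * μ * e k)
    (fun k => mul_nonneg (by positivity) (he0 k)) (fun k => by
      have : s ^ 2 * (2 * μ * e k) = e k / (4 * b) := by rw [hμ]; field_simp; ring
      rw [this, div_le_div_iff₀ (by positivity) (by norm_num)]
      linarith [heb k])
  have hm : Measurable fun x : ι → ℝ => ∑ k, 2 * μ * e k / 2 * (v k ⬝ᵥ x) ^ 2 := by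
    unfold dotProduct; fun_prop
  refine le_trans (measure_mono fun x hx => ?_) ((measure_le_of_lintegral_exp_le _ hm hexp
    (μ * (8 * s ^ 2 * B.trace))).trans (ENNReal.ofReal_le_ofReal (Real.exp_le_exp.2 ?_)))
  · have := mul_le_mul_of_nonneg_left (Set.mem_ofPred_eq ▸ hx) hμ0.le
    rw [hq, Finset.mul_sum] at this
    simp only [Set.mem_ofPred_eq]
    refine this.trans (le_of_eq (Finset.sum_congr rfl fun k _ => by ring))
  · rw [← Finset.mul_sum, ← htr]
    have e1 : 2 * s ^ 2 * (2 * μ * B.trace) - μ * (8 * s ^ 2 * B.trace) = -(B.trace / (2 * b)) := by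
      rw [hμ]; field_simp; ring
    rw [e1]
    refine neg_le_neg (div_le_div_of_nonneg_left htr0 (by positivity) ?_)
    have hs4 : 1 ≤ s ^ 4 := one_le_pow₀ hs
    nlinarith

/-- Two-sided exponential tail bound for a positive semi-definite quadratic form in independent
sub-Gaussian variables. -/
theorem measure_quadratic_notMem_le (hs : 1 ≤ s) (h : ∀ i, IsStdSubGaussian s (ν i))
    (hB : B.PosSemidef) (hb0 : 0 < b) (hb : ∀ x, x ⬝ᵥ B.mulVec x ≤ b * (x ⬝ᵥ x)) :
    Measure.pi ν {x | ¬ (B.trace / 2 ≤ x ⬝ᵥ B.mulVec x ∧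
        x ⬝ᵥ B.mulVec x ≤ 8 * s ^ 2 * B.trace)}
      ≤ 3 * ENNReal.ofReal (Real.exp (-(B.trace / (4096 * s ^ 4 * b)))) := by
  set δ := ENNReal.ofReal (Real.exp (-(B.trace / (4096 * s ^ 4 * b))))
  have h1 := measure_diag_le hs h hB hb0 hb
  have h2 := measure_offDiag_le hs h hB hb0 hb
  have h3 := measure_quadratic_ge_le hs h hB hb0 hb
  set S1 := {x : ι → ℝ | ∑ i, B i i * x i ^ 2 ≤ 3 / 4 * B.trace} with hS1
  set S2 := {x : ι → ℝ | ∑ i, ∑ j, (if i = j then 0 else x i * B i j * x j) ≤ -(B.trace / 4)}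
    with hS2
  set S3 := {x : ι → ℝ | 8 * s ^ 2 * B.trace ≤ x ⬝ᵥ B.mulVec x} with hS3
  have hle : Measure.pi ν (S1 ∪ S2 ∪ S3) ≤ 3 * δ :=
    calc _ ≤ Measure.pi ν (S1 ∪ S2) + Measure.pi ν S3 := measure_union_le _ _
      _ ≤ Measure.pi ν S1 + Measure.pi ν S2 + Measure.pi ν S3 := by
          gcongr; exact measure_union_le _ _
      _ ≤ δ + δ + δ := by gcongr
      _ = 3 * δ := by ring
  refine (measure_mono fun x hx => ?_).trans hle
  simp only [Set.mem_union, hS1, hS2, hS3, Set.mem_ofPred_eq] at hx ⊢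
  by_contra! hc
  refine hx ⟨?_, hc.2.le⟩
  rw [quadratic_eq_diag_add_offDiag]
  linarith [hc.1.1, hc.1.2]

end HansonWright

/-! ### Nets of the unit sphere -/

open Metric Module in
open scoped Function in
/-- Volume bound for an `ε`-separated subset of the unit sphere. -/
theorem card_le_of_separated_sphere {V : Type*} [NormedAddCommGroup V] [NormedSpace ℝ V]
    [FiniteDimensional ℝ V] {ε : ℝ} (hε : 0 < ε) (N : Finset V) (hN : ∀ v ∈ N, ‖v‖ = 1)
    (hsep : ∀ v ∈ N, ∀ w ∈ N, v ≠ w → ε ≤ ‖v - w‖) :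
    (N.card : ℝ) ≤ (1 + 2 / ε) ^ finrank ℝ V := by
  borelize V
  let μ : Measure V := Measure.addHaar
  have hδ : 0 < ε / 2 := by positivity
  have hρ : 0 < 1 + ε / 2 := by positivity
  have D : Set.Pairwise (N : Set V) (Disjoint on fun c => ball (c : V) (ε / 2)) := by
    rintro c hc d hd hcd
    apply ball_disjoint_ball
    rw [dist_eq_norm, add_halves]
    exact hsep c hc d hd hcd
  have hsub : (⋃ c ∈ N, ball (c : V) (ε / 2)) ⊆ ball (0 : V) (1 + ε / 2) := by
    refine Set.iUnion₂_subset fun x hx => ball_subset_ball' ?_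
    rw [dist_zero_right, hN x hx, add_comm]
  have I : (N.card : ℝ≥0∞) * ENNReal.ofReal ((ε / 2) ^ finrank ℝ V) * μ (ball 0 1) ≤
      ENNReal.ofReal ((1 + ε / 2) ^ finrank ℝ V) * μ (ball 0 1) :=
    calc _ = μ (⋃ c ∈ N, ball (c : V) (ε / 2)) := by
          rw [measure_biUnion_finset D fun c _ => measurableSet_ball]
          simp only [μ.addHaar_ball_of_pos _ hδ, Finset.sum_const, nsmul_eq_mul, mul_assoc]
      _ ≤ μ (ball (0 : V) (1 + ε / 2)) := measure_mono hsub
      _ = _ := by simp only [μ.addHaar_ball_of_pos _ hρ]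
  have J := (ENNReal.mul_le_mul_iff_left (measure_ball_pos _ _ zero_lt_one).ne'
    measure_ball_lt_top.ne).1 I
  have K := ENNReal.toReal_le_of_le_ofReal (pow_nonneg hρ.le _) J
  rw [ENNReal.toReal_mul, ENNReal.toReal_natCast, ENNReal.toReal_ofReal (by positivity),
    ← le_div_iff₀ (by positivity), ← div_pow] at K
  have e : (1 + ε / 2) / (ε / 2) = 1 + 2 / ε := by field_simp; ring
  rwa [e] at K

/-- The unit sphere of a `d`-dimensional space has an `ε`-net of at most `(1 + 2 / ε) ^ d`
points. -/
theorem exists_sphere_net (V : Type*) [NormedAddCommGroup V] [NormedSpace ℝ V]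
    [FiniteDimensional ℝ V] {ε : ℝ} (hε : 0 < ε) :
    ∃ N : Finset V, (∀ v ∈ N, ‖v‖ = 1) ∧
      (N.card : ℝ) ≤ (1 + 2 / ε) ^ Module.finrank ℝ V ∧
      ∀ u : V, ‖u‖ = 1 → ∃ v ∈ N, ‖u - v‖ ≤ ε := by
  classical
  -- The volume bound caps the size of separated sets, so one of maximal cardinality exists; a point
  -- far from all of it could be added.
  let p : ℕ → Prop := fun k => ∃ N : Finset V, N.card = k ∧ (∀ v ∈ N, ‖v‖ = 1) ∧
    ∀ v ∈ N, ∀ w ∈ N, v ≠ w → ε ≤ ‖v - w‖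
  obtain ⟨m, hm⟩ := exists_nat_ge ((1 + 2 / ε) ^ Module.finrank ℝ V)
  have hbound : ∀ k, p k → k ≤ m := by
    rintro k ⟨N, rfl, h1, h2⟩
    exact_mod_cast (card_le_of_separated_sphere hε N h1 h2).trans hm
  have h0 : p 0 := ⟨∅, by simp⟩
  have hg := Nat.findGreatest_spec (P := p) (Nat.zero_le m) h0
  obtain ⟨N, hcard, h1, h2⟩ := id hg
  refine ⟨N, h1, card_le_of_separated_sphere hε N h1 h2, fun u hu => ?_⟩
  by_contra! hc
  have hun : u ∉ N := fun h => by
    have := hc u h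
    rw [sub_self, norm_zero] at this
    linarith
  have hp : p (N.card + 1) := by
    refine ⟨insert u N, Finset.card_insert_of_notMem hun, ?_, ?_⟩
    · intro v hv
      rcases Finset.mem_insert.1 hv with rfl | hv
      · exact hu
      · exact h1 v hv
    · intro v hv w hw hvw
      rcases Finset.mem_insert.1 hv with hv | hv <;>
        rcases Finset.mem_insert.1 hw with hw | hw
      · exact absurd (hv.trans hw.symm) hvw
      · exact hv ▸ (hc w hw).le
      · rw [norm_sub_rev]; exact hw ▸ (hc v hv).le
      · exact h2 v hv w hw hvw
  have := Nat.le_findGreatest (P := p) (hbound _ hp) hp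
  omega

/-- A linear map controlled on an `ε`-net of the unit sphere is bounded below on the sphere. -/
theorem le_norm_of_sphere_net {V W : Type*} [NormedAddCommGroup V] [NormedSpace ℝ V]
    [NormedAddCommGroup W] [NormedSpace ℝ W] (D : V →L[ℝ] W)
    {ε a c : ℝ} (hε : ε ≤ 1 / 2) (hc : 0 ≤ c) {N : Finset V}
    (hnet : ∀ u : V, ‖u‖ = 1 → ∃ v ∈ N, ‖u - v‖ ≤ ε)
    (hN : ∀ v ∈ N, a ≤ ‖D v‖ ∧ ‖D v‖ ≤ c) {u : V} (hu : ‖u‖ = 1) : a - 2 * c * ε ≤ ‖D u‖ := by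
  obtain ⟨v, hv, hv2⟩ := hnet u hu
  have hε0 : 0 ≤ ε := (norm_nonneg _).trans hv2
  -- The operator norm bounds itself: `‖D‖ ≤ c + ‖D‖ / 2`, since every unit vector is within `1 / 2`
  -- of the net.
  have hD : ‖D‖ ≤ 2 * c := by
    have : ‖D‖ ≤ c + ‖D‖ / 2 := by
      refine D.opNorm_le_of_unit_norm (by positivity) fun x hx => ?_
      obtain ⟨w, hw, hw2⟩ := hnet x hx
      have e : D x = D w + D (x - w) := by rw [← map_add]; simp
      rw [e]
      refine (norm_add_le _ _).trans (add_le_add (hN w hw).2 ((D.le_opNorm _).trans ?_))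
      rw [div_eq_mul_inv]
      exact mul_le_mul_of_nonneg_left (by linarith) (norm_nonneg _)
    linarith
  have e : D v = D u - D (u - v) := by rw [← map_sub]; simp
  have h1 : ‖D v‖ ≤ ‖D u‖ + ‖D (u - v)‖ := by rw [e]; exact norm_sub_le _ _
  have h2 : ‖D (u - v)‖ ≤ 2 * c * ε :=
    (D.le_opNorm _).trans (mul_le_mul hD hv2 (norm_nonneg _) (by positivity))
  linarith [(hN v hv).1]

/-! ### Smallest singular value and surjectivity from the adjoint -/

section SingularValues

variable {V W : Type*} [NormedAddCommGroup V] [InnerProductSpace ℝ V] [FiniteDimensional ℝ V]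
  [NormedAddCommGroup W] [InnerProductSpace ℝ W] [FiniteDimensional ℝ W]

theorem adjoint_injective_of_le (T : V →ₗ[ℝ] W) {t : ℝ} (ht : 0 < t)
    (h : ∀ u, t * ‖u‖ ^ 2 ≤ ‖T.adjoint u‖ ^ 2) : Function.Injective T.adjoint := by
  rw [injective_iff_map_eq_zero]
  intro u hu
  have := h u
  rw [hu, norm_zero] at this
  by_contra hne
  have : 0 < ‖u‖ := norm_pos_iff.2 hne
  nlinarith [mul_pos ht (pow_pos this 2)]

theorem surjective_of_le_adjoint (T : V →ₗ[ℝ] W) {t : ℝ} (ht : 0 < t)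
    (h : ∀ u, t * ‖u‖ ^ 2 ≤ ‖T.adjoint u‖ ^ 2) : Function.Surjective T := by
  have hinj := adjoint_injective_of_le T ht h
  rw [← LinearMap.range_eq_top, ← Submodule.orthogonal_eq_bot_iff, Submodule.eq_bot_iff]
  intro u hu
  apply hinj
  rw [map_zero, ← inner_self_eq_zero (𝕜 := ℝ), LinearMap.adjoint_inner_left]
  exact Submodule.inner_left_of_mem_orthogonal (LinearMap.mem_range_self T _) hu

/-- If the adjoint of `T` is bounded below, then so is the smallest of the `dim W` largest
singular values of `T`. -/
theorem le_sq_singularValues_of_le_adjoint (T : V →ₗ[ℝ] W) {t : ℝ} (ht : 0 < t)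
    (h : ∀ u, t * ‖u‖ ^ 2 ≤ ‖T.adjoint u‖ ^ 2) {n : ℕ} (hn : Module.finrank ℝ W = n)
    (hn0 : 0 < n) : t ≤ T.singularValues (n - 1) ^ 2 := by
  have hinj := adjoint_injective_of_le T ht h
  have hrange : Module.finrank ℝ (LinearMap.range T.adjoint) = n := by
    rw [LinearMap.finrank_range_of_inj hinj, hn]
  have hnV : n ≤ Module.finrank ℝ V := hrange ▸ Submodule.finrank_le _
  set m := Module.finrank ℝ V with hm
  let S := T.isSymmetric_adjoint_comp_self
  let q := S.eigenvectorBasis hm.symm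
  let e := S.eigenvalues hm.symm
  have hi : n - 1 < m := by omega
  -- Courant-Fischer: with 0-based indices, the eigenvectors from `n - 1` on span `m - n + 1`
  -- dimensions, so their span meets the `n`-dimensional range of the adjoint. A common vector is
  -- stretched by at least `√t` and at most `σ_{n-1}`.
  let J : Finset (Fin m) := Finset.univ.filter fun i => n - 1 ≤ i.val
  have hJ : J.card = m - (n - 1) := by
    have : J = Finset.Ici ⟨n - 1, hi⟩ := by
      ext i; simp [J, Fin.le_def]
    rw [this, Fin.card_Ici]
  let U : Submodule ℝ V := Submodule.span ℝ (Set.range fun i : J => q i)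
  have hU : Module.finrank ℝ U = m - (n - 1) := by
    rw [finrank_span_eq_card, Fintype.card_coe, hJ]
    exact q.orthonormal.linearIndependent.comp _ Subtype.val_injective
  have hne : LinearMap.range T.adjoint ⊓ U ≠ ⊥ := fun hbot => by
    have h1 := Submodule.finrank_sup_add_finrank_inf_eq (LinearMap.range T.adjoint) U
    rw [hbot, finrank_bot, hrange, hU] at h1
    have h2 := Submodule.finrank_le (LinearMap.range T.adjoint ⊔ U)
    omega
  obtain ⟨x, ⟨⟨u, rfl⟩, hxU⟩, hx0⟩ := Submodule.exists_mem_ne_zero_of_ne_bot hne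
  set x := T.adjoint u with hx
  have hxpos : 0 < ‖x‖ := norm_pos_iff.2 hx0
  have hlow : t * ‖x‖ ^ 2 ≤ ‖T x‖ ^ 2 := by
    have h1 : ‖x‖ ^ 2 ≤ ‖T x‖ * ‖u‖ := by
      rw [← real_inner_self_eq_norm_sq]
      nth_rewrite 1 [hx]
      rw [LinearMap.adjoint_inner_left, mul_comm]
      exact real_inner_le_norm _ _
    have h2 := h u
    rw [← hx] at h2
    have h3 : (‖x‖ ^ 2) ^ 2 ≤ (‖T x‖ * ‖u‖) ^ 2 := pow_le_pow_left₀ (by positivity) h1 2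
    have h4 : t * ‖x‖ ^ 2 * ‖x‖ ^ 2 ≤ ‖T x‖ ^ 2 * ‖x‖ ^ 2 := by
      calc _ = t * (‖x‖ ^ 2) ^ 2 := by ring
        _ ≤ t * (‖T x‖ * ‖u‖) ^ 2 := by gcongr
        _ = ‖T x‖ ^ 2 * (t * ‖u‖ ^ 2) := by ring
        _ ≤ _ := by gcongr
    exact le_of_mul_le_mul_right h4 (by positivity)
  have hzero : ∀ i, i ∉ J → inner ℝ (q i) x = 0 := fun i hiJ => by
    have : U ≤ (ℝ ∙ q i)ᗮ := by
      rw [Submodule.span_le]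
      rintro _ ⟨j, rfl⟩
      rw [SetLike.mem_coe, Submodule.mem_orthogonal_singleton_iff_inner_right]
      refine q.orthonormal.2 fun hij => hiJ ?_
      rw [hij]; exact j.2
    exact (Submodule.mem_orthogonal_singleton_iff_inner_right).1 (this hxU)
  have hup : ‖T x‖ ^ 2 ≤ T.singularValues (n - 1) ^ 2 * ‖x‖ ^ 2 := by
    have e1 : ‖T x‖ ^ 2 = ∑ i, e i * (inner ℝ (q i) x) ^ 2 := by
      rw [← real_inner_self_eq_norm_sq, ← LinearMap.adjoint_inner_right,
        ← q.sum_inner_mul_inner]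
      refine Finset.sum_congr rfl fun i _ => ?_
      have h5 : inner ℝ (q i) (T.adjoint (T x)) = e i * inner ℝ (q i) x := by
        have h6 := S.apply_eigenvectorBasis hm.symm i
        have h7 := S (q i) x
        simp only [LinearMap.comp_apply] at h6 h7
        rw [← h7, h6, real_inner_smul_left]
        rfl
      rw [h5, real_inner_comm]
      ring
    have e2 : ‖x‖ ^ 2 = ∑ i, (inner ℝ (q i) x) ^ 2 := by
      rw [← real_inner_self_eq_norm_sq, ← q.sum_inner_mul_inner]
      exact Finset.sum_congr rfl fun i _ => by rw [real_inner_comm]; ring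
    rw [e1, e2, Finset.mul_sum, T.sq_singularValues_of_lt hm.symm hi]
    refine Finset.sum_le_sum fun i _ => ?_
    by_cases hiJ : i ∈ J
    · refine mul_le_mul_of_nonneg_right (S.eigenvalues_antitone hm.symm ?_) (sq_nonneg _)
      simpa [J, Fin.le_def] using hiJ
    · rw [hzero i hiJ]; simp
  exact le_of_mul_le_mul_right (hlow.trans hup) (by positivity)

end SingularValues

/-! ### From the model's assumptions to laws and matrices -/

/-- The strict inequality `M < s` yields an admissible `t < s` below the infimum's bound, so
attainment of the infimum is not needed. -/
theorem isStdSubGaussian_map {Ω : Type*} [MeasurableSpace Ω] {μ : Measure Ω}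
    [IsProbabilityMeasure μ] {U : Ω → ℝ} (hU : AEMeasurable U μ) {M s : ℝ} (hs : 0 < s)
    (hMs : M < s) (hmean : ∫ ω, U ω ∂μ = 0) (hvar : variance U μ = 1)
    (hpsi : psi2Norm μ U ≤ ENNReal.ofReal M) : IsStdSubGaussian s (μ.map U) := by
  have hlt : psi2Norm μ U < ENNReal.ofReal s :=
    hpsi.trans_lt ((ENNReal.ofReal_lt_ofReal_iff hs).2 hMs)
  simp only [psi2Norm, iInf_lt_iff] at hlt
  obtain ⟨t, ht, hint, hts⟩ := hlt
  have hts' : (t : ℝ) ≤ s := by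
    have := ENNReal.toReal_mono ENNReal.ofReal_ne_top hts.le
    rwa [ENNReal.coe_toReal, ENNReal.toReal_ofReal hs.le] at this
  have ht' : 0 < (t : ℝ) := ht
  have hle : ∫⁻ ω, ENNReal.ofReal (Real.exp (U ω ^ 2 / s ^ 2)) ∂μ ≤ 2 := by
    refine (lintegral_mono fun ω => ENNReal.ofReal_le_ofReal (Real.exp_le_exp.2 ?_)).trans hint
    gcongr
  have hm : AEStronglyMeasurable (fun ω => Real.exp (U ω ^ 2 / s ^ 2)) μ :=
    AEMeasurable.aestronglyMeasurable (by fun_prop)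
  have h0 : 0 ≤ᵐ[μ] fun ω => Real.exp (U ω ^ 2 / s ^ 2) :=
    Filter.Eventually.of_forall fun ω => (Real.exp_pos _).le
  refine ⟨?_, ?_, ?_, ?_⟩
  · rw [integral_map hU (by fun_prop)]
    exact hmean
  · rw [integral_map hU (by fun_prop)]
    rw [variance_eq_integral hU, hmean] at hvar
    simpa using hvar
  · rw [integrable_map_measure (by fun_prop) hU]
    exact ⟨hm, (hasFiniteIntegral_iff_ofReal h0).2 (hle.trans_lt (by simp))⟩
  · rw [integral_map hU (by fun_prop), integral_eq_lintegral_of_nonneg_ae h0 hm]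
    exact ENNReal.toReal_le_of_le_ofReal (by norm_num) (by simpa using hle)

theorem posSemidef_covMat {Ω : Type*} [MeasurableSpace Ω] {d : ℕ} {μ : Measure Ω}
    [IsFiniteMeasure μ] {V : Ω → Fin d → ℝ} (hV : ∀ j, MemLp (fun ω => V ω j) 2 μ) :
    (covMat μ V).PosSemidef := by
  refine Matrix.PosSemidef.of_dotProduct_mulVec_nonneg ?_ fun x => ?_
  · ext i j
    simp [covMat, covariance_comm]
  · have h := variance_nonneg (fun ω => ∑ i, x i * V ω i) μ
    rw [← covariance_self (by
        have := fun j => (hV j).aestronglyMeasurable.aemeasurable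
        fun_prop),
      covariance_fun_sum_fun_sum (fun i => (hV i).const_mul (x i))
        (fun i => (hV i).const_mul (x i))] at h
    refine h.trans (le_of_eq ?_)
    simp only [star_trivial, dotProduct, Matrix.mulVec, covMat, Matrix.of_apply, Finset.mul_sum,
      covariance_const_mul_left, covariance_const_mul_right]
    exact Finset.sum_congr rfl fun i _ => Finset.sum_congr rfl fun j _ => by ring

open scoped MatrixOrder in
theorem transpose_matSqrt {d : ℕ} (Q : Matrix (Fin d) (Fin d) ℝ) :
    (matSqrt Q).transpose = matSqrt Q := by
  have h : (matSqrt Q).PosSemidef := Matrix.nonneg_iff_posSemidef.1 (CFC.sqrt_nonneg Q)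
  simpa [Matrix.IsHermitian] using h.isHermitian

open scoped MatrixOrder in
theorem matSqrt_mul_self {d : ℕ} {Q : Matrix (Fin d) (Fin d) ℝ} (hQ : Q.PosSemidef) :
    matSqrt Q * matSqrt Q = Q :=
  CFC.sqrt_mul_sqrt_self Q (Matrix.nonneg_iff_posSemidef.2 hQ)

theorem euclNorm_sq {d : ℕ} (v : Fin d → ℝ) : euclNorm v ^ 2 = v ⬝ᵥ v := by
  rw [euclNorm, EuclideanSpace.real_norm_sq_eq]
  simp [dotProduct, sq]

theorem euclNorm_matSqrt_mulVec_sq {d : ℕ} {Q : Matrix (Fin d) (Fin d) ℝ} (hQ : Q.PosSemidef)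
    (x : Fin d → ℝ) : euclNorm ((matSqrt Q).mulVec x) ^ 2 = x ⬝ᵥ Q.mulVec x := by
  rw [euclNorm_sq, Matrix.dotProduct_mulVec, ← Matrix.mulVec_transpose, transpose_matSqrt,
    Matrix.mulVec_mulVec, matSqrt_mul_self hQ, dotProduct_comm]

theorem dotProduct_mulVec_le_opNorm {d : ℕ} (Q : Matrix (Fin d) (Fin d) ℝ) (x : Fin d → ℝ) :
    x ⬝ᵥ Q.mulVec x ≤ opNorm Q * (x ⬝ᵥ x) := by
  have h1 := real_inner_le_norm (WithLp.toLp 2 (Q.mulVec x)) (WithLp.toLp 2 x)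
  have h2 := (Matrix.toEuclideanCLM (n := Fin d) (𝕜 := ℝ) Q).le_opNorm (WithLp.toLp 2 x)
  rw [Matrix.toEuclideanCLM_toLp] at h2
  have h3 : inner ℝ (WithLp.toLp 2 (Q.mulVec x)) (WithLp.toLp 2 x) = x ⬝ᵥ Q.mulVec x := by
    simp [EuclideanSpace.inner_eq_star_dotProduct]
  rw [h3] at h1
  refine h1.trans ((mul_le_mul_of_nonneg_right h2 (norm_nonneg _)).trans (le_of_eq ?_))
  rw [← euclNorm_sq, euclNorm, opNorm]
  ring

/-! ### Trace and tails of the projected noise -/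

/-- Removing a subspace of dimension `r` costs at most `r ‖Q‖` of the trace. -/
theorem trace_sub_le_sum_orthogonal {p : ℕ} {Q : Matrix (Fin p) (Fin p) ℝ} (hQ : Q.PosSemidef)
    (U : Submodule ℝ (EuclideanSpace ℝ (Fin p))) :
    Q.trace - Module.finrank ℝ U * opNorm Q
      ≤ ∑ j, ‖Uᗮ.starProjection (WithLp.toLp 2 ((matSqrt Q).mulVec (Pi.single j 1)))‖ ^ 2 := by
  let S := matSqrt Q
  let y : Fin p → EuclideanSpace ℝ (Fin p) := fun j => WithLp.toLp 2 (S.mulVec (Pi.single j 1))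
  have hsplit : ∀ j, ‖y j‖ ^ 2 = ‖U.starProjection (y j)‖ ^ 2 + ‖Uᗮ.starProjection (y j)‖ ^ 2 :=
    fun j => U.norm_sq_eq_add_norm_sq_starProjection (y j)
  have htr : ∑ j, ‖y j‖ ^ 2 = Q.trace := by
    refine Finset.sum_congr rfl fun j _ => ?_
    have := euclNorm_matSqrt_mulVec_sq hQ (Pi.single j 1)
    rw [euclNorm] at this
    rw [this]
    simp
  let q := stdOrthonormalBasis ℝ U
  -- With an orthonormal basis `q_k` of `U`, symmetry of the square root `S` turns this sum into `∑
  -- ‖S q_k‖² = ∑ q_kᵀ Q q_k`, each term at most `‖Q‖`.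
  have hU : ∑ j, ‖U.starProjection (y j)‖ ^ 2 ≤ Module.finrank ℝ U * opNorm Q := by
    have h1 : ∀ j, ‖U.starProjection (y j)‖ ^ 2
        = ∑ k, (S.mulVec (q k : EuclideanSpace ℝ (Fin p)).ofLp j) ^ 2 := fun j => by
      rw [Submodule.starProjection_apply, Submodule.norm_coe, ← real_inner_self_eq_norm_sq,
        ← q.sum_inner_mul_inner]
      refine Finset.sum_congr rfl fun k _ => ?_
      rw [real_inner_comm, ← sq]
      congr 1
      rw [Submodule.coe_inner, ← Submodule.starProjection_apply,
        ← Submodule.inner_starProjection_left_eq_right,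
        Submodule.starProjection_eq_self_iff.2 (q k).2]
      simp only [y, EuclideanSpace.inner_eq_star_dotProduct, star_trivial]
      rw [dotProduct_comm, Matrix.dotProduct_mulVec, ← Matrix.mulVec_transpose,
        transpose_matSqrt]
      simp [S]
    simp_rw [h1]
    rw [Finset.sum_comm]
    have h2 : ∀ k, ∑ j, (S.mulVec (q k : EuclideanSpace ℝ (Fin p)).ofLp j) ^ 2 ≤ opNorm Q :=
      fun k => by
        have h3 := euclNorm_matSqrt_mulVec_sq hQ (q k : EuclideanSpace ℝ (Fin p)).ofLp
        have h4 := dotProduct_mulVec_le_opNorm Q (q k : EuclideanSpace ℝ (Fin p)).ofLp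
        rw [← h3, euclNorm_sq, ← euclNorm_sq (q k : EuclideanSpace ℝ (Fin p)).ofLp, euclNorm] at h4
        have h5 : ‖(q k : EuclideanSpace ℝ (Fin p))‖ = 1 := q.orthonormal.1 k
        simp only [WithLp.toLp_ofLp, h5, one_pow, mul_one] at h4
        simpa [dotProduct, sq] using h4
    refine (Finset.sum_le_sum fun k _ => h2 k).trans (le_of_eq ?_)
    simp
  have h6 : ∑ j, ‖y j‖ ^ 2 = _ := Finset.sum_congr rfl fun j _ => hsplit j
  rw [Finset.sum_add_distrib, htr] at h6
  simp only [y, S] at h6 hU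
  linarith

/-- `‖T x‖²` is the quadratic form of the Gram matrix of the images of the basis vectors, whose
trace is `τ`. -/
theorem measure_norm_sq_notMem_le {ι : Type*} [Fintype ι] [DecidableEq ι] {s b : ℝ}
    {ν : ι → Measure ℝ} [∀ i, IsProbabilityMeasure (ν i)] (hs : 1 ≤ s)
    (h : ∀ i, IsStdSubGaussian s (ν i)) {H : Type*} [NormedAddCommGroup H]
    [InnerProductSpace ℝ H] (T : (ι → ℝ) →ₗ[ℝ] H) (hb0 : 0 < b)
    (hb : ∀ x, ‖T x‖ ^ 2 ≤ b * (x ⬝ᵥ x)) {τ : ℝ} (hτ : ∑ a, ‖T (Pi.single a 1)‖ ^ 2 = τ) :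
    Measure.pi ν {x | ¬ (τ / 2 ≤ ‖T x‖ ^ 2 ∧ ‖T x‖ ^ 2 ≤ 8 * s ^ 2 * τ)}
      ≤ 3 * ENNReal.ofReal (Real.exp (-(τ / (4096 * s ^ 4 * b)))) := by
  let B : Matrix ι ι ℝ := Matrix.gram ℝ fun a => T (Pi.single a 1)
  have hB : B.PosSemidef := Matrix.posSemidef_gram ℝ _
  have hq : ∀ x, x ⬝ᵥ B.mulVec x = ‖T x‖ ^ 2 := fun x => by
    have e : T x = ∑ a, x a • T (Pi.single a 1) := by
      conv_lhs => rw [pi_eq_sum_univ' x, map_sum]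
      refine Finset.sum_congr rfl fun a _ => ?_
      rw [map_smul]
    rw [e, ← real_inner_self_eq_norm_sq, sum_inner]
    simp only [dotProduct, Matrix.mulVec, B, Matrix.gram_apply, inner_sum, real_inner_smul_left,
      real_inner_smul_right, Finset.mul_sum]
    exact Finset.sum_congr rfl fun i _ => Finset.sum_congr rfl fun j _ => by ring
  have htr : B.trace = τ := by
    rw [← hτ]
    simp [B, Matrix.trace, Matrix.gram_apply]
  have := measure_quadratic_notMem_le hs h hB hb0 fun x => (hq x).trans_le (hb x)
  simpa only [hq, htr] using this

theorem map_uncurry_pi {n p : ℕ} (ν : Fin p → Measure ℝ) [∀ j, IsProbabilityMeasure (ν j)] :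
    (Measure.pi fun _ : Fin n => Measure.pi ν).map (fun x a => x a.1 a.2)
      = Measure.pi fun a : Fin n × Fin p => ν a.2 := by
  refine (Measure.pi_eq fun S hS => ?_).symm
  rw [Measure.map_apply (by fun_prop) (MeasurableSet.univ_pi hS)]
  have e : (fun (x : Fin n → Fin p → ℝ) (a : Fin n × Fin p) => x a.1 a.2) ⁻¹' Set.univ.pi S
      = Set.univ.pi fun i => Set.univ.pi fun j => S (i, j) := by
    ext x
    simp [Set.mem_pi, Prod.forall]
  rw [e, Measure.pi_pi]
  simp_rw [Measure.pi_pi]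
  rw [Fintype.prod_prod_type]

/-- Tail bound for the norm of a projected combination of independent sub-Gaussian vectors. -/
theorem measure_norm_sq_sum_notMem_le {n p : ℕ} {s b : ℝ} {ν : Fin p → Measure ℝ}
    [∀ j, IsProbabilityMeasure (ν j)] (hs : 1 ≤ s) (h : ∀ j, IsStdSubGaussian s (ν j))
    {H : Type*} [NormedAddCommGroup H] [InnerProductSpace ℝ H]
    (R : (Fin p → ℝ) →ₗ[ℝ] H) (hb0 : 0 < b)
    (hb : ∀ x, ‖R x‖ ^ 2 ≤ b * (x ⬝ᵥ x)) {τ : ℝ} (hτ : ∑ j, ‖R (Pi.single j 1)‖ ^ 2 = τ)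
    {v : Fin n → ℝ} (hv : v ⬝ᵥ v = 1) :
    (Measure.pi fun _ : Fin n => Measure.pi ν) {x | ¬ (τ / 2 ≤ ‖R (∑ i, v i • x i)‖ ^ 2 ∧
        ‖R (∑ i, v i • x i)‖ ^ 2 ≤ 8 * s ^ 2 * τ)}
      ≤ 3 * ENNReal.ofReal (Real.exp (-(τ / (4096 * s ^ 4 * b)))) := by
  -- Combining the rows with unit weights is a contraction by Cauchy-Schwarz, and `∑ vᵢ² = 1` leaves
  -- the trace unchanged; hence `b` and `τ` do not depend on `v`.
  let L : (Fin n × Fin p → ℝ) →ₗ[ℝ] (Fin p → ℝ) :=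
    ∑ i, v i • LinearMap.funLeft ℝ ℝ fun j => (i, j)
  have hL : ∀ x, L x = ∑ i, v i • fun j => x (i, j) := fun x => by
    simp only [L, LinearMap.sum_apply, LinearMap.smul_apply]
    rfl
  have hLx : ∀ x j, L x j = ∑ i, v i * x (i, j) := fun x j => by
    rw [hL]; simp [Finset.sum_apply]
  have hLb : ∀ x, L x ⬝ᵥ L x ≤ x ⬝ᵥ x := fun x => by
    simp only [dotProduct, Fintype.sum_prod_type, hLx]
    rw [Finset.sum_comm]
    refine Finset.sum_le_sum fun j _ => ?_
    have h1 := Finset.sum_mul_sq_le_sq_mul_sq Finset.univ v fun i => x (i, j)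
    have h2 : ∑ i, v i ^ 2 = 1 := by rw [← hv]; simp [dotProduct, sq]
    rw [h2, one_mul] at h1
    simpa [sq] using h1
  have hLs : ∀ a : Fin n × Fin p, L (Pi.single a 1) = v a.1 • Pi.single a.2 1 := fun a => by
    ext j
    rw [hLx, Finset.sum_eq_single a.1]
    · simp [Pi.single_apply, Prod.ext_iff]
    · intro i _ hi
      simp [Prod.ext_iff, hi]
    · simp
  have hτ' : ∑ a, ‖(R ∘ₗ L) (Pi.single a 1)‖ ^ 2 = τ := by
    simp only [LinearMap.comp_apply, hLs, map_smul, norm_smul, mul_pow, Fintype.sum_prod_type]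
    rw [← Finset.sum_mul_sum, hτ]
    have : ∑ i, ‖v i‖ ^ 2 = 1 := by rw [← hv]; simp [dotProduct, sq]
    rw [this, one_mul]
  have key := measure_norm_sq_notMem_le (ν := fun a : Fin n × Fin p => ν a.2) hs (fun a => h a.2)
    (R ∘ₗ L) hb0 (fun x => (hb (L x)).trans (mul_le_mul_of_nonneg_left (hLb x) hb0.le)) hτ'
  have hm : Measurable fun x : Fin n × Fin p → ℝ => ‖(R ∘ₗ L) x‖ ^ 2 :=
    ((LinearMap.continuous_of_finiteDimensional (R ∘ₗ L)).norm.pow 2).measurable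
  have hset : MeasurableSet {x : Fin n × Fin p → ℝ | ¬ (τ / 2 ≤ ‖(R ∘ₗ L) x‖ ^ 2 ∧
      ‖(R ∘ₗ L) x‖ ^ 2 ≤ 8 * s ^ 2 * τ)} :=
    ((measurableSet_le measurable_const hm).inter (measurableSet_le hm measurable_const)).compl
  rw [← map_uncurry_pi, Measure.map_apply (by fun_prop) hset] at key
  refine le_trans (le_of_eq ?_) key
  congr 1
  ext x
  simp only [Set.mem_preimage, Set.mem_ofPred_eq, LinearMap.comp_apply, hL]

namespace IsFactorModel

variable {n p K : ℕ} {Ω₀ Ω : Type*} [MeasurableSpace Ω₀] [MeasurableSpace Ω]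
    {P₀ : Measure Ω₀} {P : Measure Ω}
    {Z : Ω₀ → Fin K → ℝ} {E : Ω₀ → Fin p → ℝ} {ε : Ω₀ → ℝ}
    {Zs : Fin n → Ω → Fin K → ℝ} {Es : Fin n → Ω → Fin p → ℝ} {εs : Fin n → Ω → ℝ}

theorem identDistrib_noise (hmod : IsFactorModel P₀ P Z E ε Zs Es εs) (i : Fin n) :
    IdentDistrib (Es i) E P P₀ :=
  (hmod.copies i).comp (u := fun q : (Fin K → ℝ) × (Fin p → ℝ) × ℝ => q.2.1) (by fun_prop)

theorem map_noise (hmod : IsFactorModel P₀ P Z E ε Zs Es εs) :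
    P.map (fun ω i => Es i ω) = Measure.pi fun _ : Fin n => P₀.map E := by
  have hind : iIndepFun Es P :=
    hmod.indep_sample.comp (fun _ (q : (Fin K → ℝ) × (Fin p → ℝ) × ℝ) => q.2.1)
      fun _ => by fun_prop
  rw [hind.map_fun_eq_pi_map fun i => (hmod.identDistrib_noise i).aemeasurable_fst]
  simp_rw [fun i => (hmod.identDistrib_noise i).map_eq]

theorem measure_noise_notMem_le [IsProbabilityMeasure P₀]
    (hmod : IsFactorModel P₀ P Z E ε Zs Es εs) {M : ℝ} (hM : 0 < M)
    (hE : NoiseSubGaussian P₀ E M) (hop : 0 < opNorm (covMat P₀ E))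
    (Q : EuclideanSpace ℝ (Fin p) →L[ℝ] EuclideanSpace ℝ (Fin p)) (hQ : ∀ y, ‖Q y‖ ≤ ‖y‖)
    {τ : ℝ} (hτ : ∑ j, ‖Q (WithLp.toLp 2
      ((matSqrt (covMat P₀ E)).mulVec (Pi.single j 1)))‖ ^ 2 = τ)
    {v : Fin n → ℝ} (hv : v ⬝ᵥ v = 1) :
    P {ω | ¬ (τ / 2 ≤ ‖Q (WithLp.toLp 2 (∑ i, v i • Es i ω))‖ ^ 2 ∧
        ‖Q (WithLp.toLp 2 (∑ i, v i • Es i ω))‖ ^ 2 ≤ 8 * (2 * M + 1) ^ 2 * τ)}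
      ≤ 3 * ENNReal.ofReal (Real.exp
          (-(τ / (4096 * (2 * M + 1) ^ 4 * opNorm (covMat P₀ E))))) := by
  obtain ⟨Et, hEt, hmeas, hind, hmean, hvar, hpsi⟩ := hE
  set S := matSqrt (covMat P₀ E)
  have hpsd := posSemidef_covMat hmod.memLp_E
  let ν : Fin p → Measure ℝ := fun j => P₀.map fun ω => Et ω j
  have hprob : ∀ j, IsProbabilityMeasure (ν j) := fun j =>
    Measure.isProbabilityMeasure_map (hmeas j)
  have hsub : ∀ j, IsStdSubGaussian (2 * M + 1) (ν j) := fun j =>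
    isStdSubGaussian_map (hmeas j) (by linarith) (by linarith) (hmean j) (hvar j) (hpsi j)
  -- The variables `Ẽ` live on the population space, not on the sample space, so the representation
  -- is transferred through laws.
  have hlaw : P₀.map E = (Measure.pi ν).map S.mulVec := by
    rw [Measure.map_congr hEt, ← hind.map_fun_eq_pi_map hmeas,
      AEMeasurable.map_map_of_aemeasurable (Measurable.aemeasurable ?_)
        (aemeasurable_pi_lambda _ hmeas)]
    · rfl
    · exact (Continuous.matrix_mulVec continuous_const continuous_id).measurable
  have hSm : Measurable S.mulVec :=
    (Continuous.matrix_mulVec continuous_const continuous_id).measurable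
  have hprob' : IsProbabilityMeasure ((Measure.pi ν).map S.mulVec) :=
    Measure.isProbabilityMeasure_map hSm.aemeasurable
  have hlaws : P.map (fun ω i => Es i ω)
      = (Measure.pi fun _ : Fin n => Measure.pi ν).map fun x i => S.mulVec (x i) := by
    rw [hmod.map_noise, hlaw, Measure.pi_map_pi fun _ => hSm.aemeasurable]
  let R : (Fin p → ℝ) →ₗ[ℝ] EuclideanSpace ℝ (Fin p) :=
    Q.toLinearMap ∘ₗ (WithLp.linearEquiv 2 ℝ (Fin p → ℝ)).symm.toLinearMap ∘ₗ S.mulVecLin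
  have hR : ∀ x, R x = Q (WithLp.toLp 2 (S.mulVec x)) := fun x => rfl
  have key := measure_norm_sq_sum_notMem_le (n := n) (by linarith : 1 ≤ 2 * M + 1) hsub R hop
    (fun x => by
      rw [hR]
      have h1 := pow_le_pow_left₀ (norm_nonneg _) (hQ (WithLp.toLp 2 (S.mulVec x))) 2
      have h2 := euclNorm_matSqrt_mulVec_sq hpsd x
      rw [euclNorm] at h2
      exact h1.trans (h2.trans_le (dotProduct_mulVec_le_opNorm _ x))) hτ hv
  have hg : Measurable fun e : Fin n → Fin p → ℝ => ‖Q (WithLp.toLp 2 (∑ i, v i • e i))‖ ^ 2 := by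
    have : Continuous fun e : Fin n → Fin p → ℝ => WithLp.toLp 2 (∑ i, v i • e i) := by fun_prop
    exact ((Q.continuous.comp this).norm.pow 2).measurable
  have hset : MeasurableSet {e : Fin n → Fin p → ℝ |
      ¬ (τ / 2 ≤ ‖Q (WithLp.toLp 2 (∑ i, v i • e i))‖ ^ 2 ∧
        ‖Q (WithLp.toLp 2 (∑ i, v i • e i))‖ ^ 2 ≤ 8 * (2 * M + 1) ^ 2 * τ)} :=
    ((measurableSet_le measurable_const hg).inter (measurableSet_le hg measurable_const)).compl
  have h3 := congrArg (fun m => m {e : Fin n → Fin p → ℝ |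
      ¬ (τ / 2 ≤ ‖Q (WithLp.toLp 2 (∑ i, v i • e i))‖ ^ 2 ∧
        ‖Q (WithLp.toLp 2 (∑ i, v i • e i))‖ ^ 2 ≤ 8 * (2 * M + 1) ^ 2 * τ)}) hlaws
  simp only at h3
  rw [Measure.map_apply_of_aemeasurable (aemeasurable_pi_lambda _
    fun i => (hmod.identDistrib_noise i).aemeasurable_fst) hset,
    Measure.map_apply (by fun_prop) hset] at h3
  refine (le_of_eq h3).trans (le_trans (le_of_eq ?_) key)
  congr 1
  ext x
  simp only [Set.mem_preimage, Set.mem_ofPred_eq, hR, Matrix.mulVec_sum, Matrix.mulVec_smul]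

end IsFactorModel

/-! ### Interpolation, effective rank and the union bound -/

theorem mulVec_minNormEstimator_of_surjective {n p : ℕ} {X : Matrix (Fin n) (Fin p) ℝ}
    (hX : Function.Surjective (Matrix.toEuclideanLin X)) (y : Fin n → ℝ) :
    X.mulVec (minNormEstimator X y) = y := by
  obtain ⟨u, hu⟩ := hX (WithLp.toLp 2 y)
  have hu' : X.mulVec u.ofLp = y := congrArg WithLp.ofLp hu
  have h := (minNormEstimator_spec X y).1 u.ofLp
  rw [hu', sub_self] at h
  have h0 : euclNorm (X.mulVec (minNormEstimator X y) - y) = 0 :=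
    le_antisymm (h.trans (by simp [euclNorm])) (norm_nonneg _)
  rw [euclNorm, norm_eq_zero] at h0
  exact sub_eq_zero.1 (congrArg WithLp.ofLp h0)

/-- A lower bound for `‖Xᵀ u‖` gives one for the smallest singular value of `X`, and
interpolation. -/
theorem le_sigma_sq_and_interpolates {n p : ℕ} (hn : 0 < n) (X : Matrix (Fin n) (Fin p) ℝ)
    {t : ℝ} (ht : 0 < t)
    (h : ∀ u : EuclideanSpace ℝ (Fin n), ‖u‖ = 1 →
      t ≤ ‖WithLp.toLp 2 (X.transpose.mulVec u.ofLp)‖ ^ 2) :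
    t ≤ sigma n X ^ 2 ∧ ∀ y, X.mulVec (minNormEstimator X y) = y := by
  have hadj : (Matrix.toEuclideanLin X).adjoint = Matrix.toEuclideanLin X.transpose := by
    rw [← Matrix.toEuclideanLin_conjTranspose_eq_adjoint,
      Matrix.conjTranspose_eq_transpose_of_trivial]
  have h' : ∀ u, t * ‖u‖ ^ 2 ≤ ‖(Matrix.toEuclideanLin X).adjoint u‖ ^ 2 := fun u => by
    rw [hadj]
    rcases eq_or_ne u 0 with rfl | hu
    · simp
    · have hpos : 0 < ‖u‖ := norm_pos_iff.2 hu
      have h1 : t ≤ ‖Matrix.toEuclideanLin X.transpose (‖u‖⁻¹ • u)‖ ^ 2 :=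
        h (‖u‖⁻¹ • u) (by rw [norm_smul, norm_inv, norm_norm, inv_mul_cancel₀ hpos.ne'])
      rw [map_smul, norm_smul, norm_inv, norm_norm, mul_pow, inv_pow, mul_comm,
        ← div_eq_mul_inv, le_div_iff₀ (by positivity)] at h1
      exact h1
  exact ⟨le_sq_singularValues_of_le_adjoint _ ht h' (by simp) hn,
    mulVec_minNormEstimator_of_surjective (surjective_of_le_adjoint _ ht h')⟩

theorem transpose_dataMatrix_mulVec {n p K : ℕ} {Ω : Type*} (A : Matrix (Fin p) (Fin K) ℝ)
    (Zs : Fin n → Ω → Fin K → ℝ) (Es : Fin n → Ω → Fin p → ℝ) (ω : Ω) (u : Fin n → ℝ) :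
    (dataMatrix A Zs Es ω).transpose.mulVec u
      = A.mulVec (∑ i, u i • Zs i ω) + ∑ i, u i • Es i ω := by
  rw [Matrix.mulVec_sum, ← Finset.sum_add_distrib]
  ext j
  simp only [Matrix.mulVec_smul, ← smul_add]
  simp only [Matrix.mulVec, dotProduct, Matrix.transpose_apply, dataMatrix, Matrix.of_apply,
    Pi.add_apply, Finset.sum_apply, Pi.smul_apply, smul_eq_mul]
  exact Finset.sum_congr rfl fun i _ => mul_comm _ _

theorem opNorm_nonneg {p : ℕ} (Q : Matrix (Fin p) (Fin p) ℝ) : 0 ≤ opNorm Q := norm_nonneg _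

/-- If the effective rank exceeds `c ≥ 1` then the matrix is non-zero and `c ‖Q‖ < tr Q`. -/
theorem trace_pos_of_lt_effRank {p : ℕ} {Q : Matrix (Fin p) (Fin p) ℝ} {c : ℝ} (hc : 1 ≤ c)
    (h : c < effRank Q) : 0 < Q.trace ∧ 0 < opNorm Q ∧ c * opNorm Q < Q.trace := by
  unfold effRank at h
  split_ifs at h with h0
  -- The zero matrix is excluded because its conventional effective rank `1` does not exceed `c ≥
  -- 1`.
  · linarith
  · have hop : 0 < opNorm Q := by
      refine lt_of_le_of_ne (opNorm_nonneg Q) fun he => ?_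
      rw [← he, div_zero] at h
      linarith
    have h1 := (lt_div_iff₀ hop).1 h
    exact ⟨(mul_pos (by linarith) hop).trans h1, hop, h1⟩

theorem exp_neg_natCast_le_inv {n : ℕ} (hn : 0 < n) : Real.exp (-(n : ℝ)) ≤ 1 / n := by
  have hn' : (0 : ℝ) < n := by exact_mod_cast hn
  rw [Real.exp_neg, one_div]
  refine inv_anti₀ hn' ?_
  linarith [Real.add_one_le_exp (n : ℝ)]

/-- `κ` is chosen so that the tail exponent is at least `n log L + n`: the first term cancels the
net size `L ^ n`, and `exp (-n) ≤ 1 / n` remains. -/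
theorem card_mul_tail_le {n : ℕ} (hn : 0 < n) {N L s κ τ b : ℝ} (hL : 0 < L) (hs : 0 < s)
    (hb : 0 < b) (hN : N ≤ L ^ n) (hκ : κ = 8192 * s ^ 4 * (Real.log L + 1))
    (hτ : κ * n * b ≤ 2 * τ) :
    N * (3 * Real.exp (-(τ / (4096 * s ^ 4 * b)))) ≤ 3 / n := by
  have h1 : (n : ℝ) * Real.log L + n ≤ τ / (4096 * s ^ 4 * b) := by
    rw [le_div_iff₀ (by positivity)]
    rw [hκ] at hτ
    linarith
  have hLn : L ^ n = Real.exp (n * Real.log L) := by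
    rw [Real.exp_nat_mul, Real.exp_log hL]
  calc _ ≤ L ^ n * (3 * Real.exp (-(n * Real.log L + n))) := by
        refine mul_le_mul hN ?_ (by positivity) (by positivity)
        gcongr
    _ = 3 * Real.exp (-(n : ℝ)) := by
        rw [hLn, mul_left_comm, ← Real.exp_add]
        ring_nf
    _ ≤ 3 * (1 / n) := by gcongr; exact exp_neg_natCast_le_inv hn
    _ = _ := by ring

/-- On the event that the projected noise is well-behaved on a net of the sphere, all of the
singular values of the data matrix are bounded below. -/
theorem le_sigma_sq_of_net {n p K : ℕ} {Ω : Type*} (hn : 0 < n) (A : Matrix (Fin p) (Fin K) ℝ)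
    (Zs : Fin n → Ω → Fin K → ℝ) (Es : Fin n → Ω → Fin p → ℝ) (ω : Ω) {s τ : ℝ} (hs : 1 ≤ s)
    (hτ : 0 < τ) {N : Finset (EuclideanSpace ℝ (Fin n))}
    (hnet : ∀ u : EuclideanSpace ℝ (Fin n), ‖u‖ = 1 → ∃ v ∈ N, ‖u - v‖ ≤ 1 / (16 * s))
    (hN : ∀ v ∈ N,
      τ / 2 ≤ ‖(LinearMap.range (Matrix.toEuclideanLin A))ᗮ.starProjection
        (WithLp.toLp 2 (∑ i, v i • Es i ω))‖ ^ 2 ∧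
      ‖(LinearMap.range (Matrix.toEuclideanLin A))ᗮ.starProjection
        (WithLp.toLp 2 (∑ i, v i • Es i ω))‖ ^ 2 ≤ 8 * s ^ 2 * τ) :
    τ / 16 ≤ sigma n (dataMatrix A Zs Es ω) ^ 2 ∧
      ∀ y, (dataMatrix A Zs Es ω).mulVec (minNormEstimator (dataMatrix A Zs Es ω) y) = y := by
  set U := LinearMap.range (Matrix.toEuclideanLin A)
  refine le_sigma_sq_and_interpolates hn _ (by positivity) fun u hu => ?_
  let X := dataMatrix A Zs Es ω
  let D : EuclideanSpace ℝ (Fin n) →L[ℝ] EuclideanSpace ℝ (Fin p) :=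
    Uᗮ.starProjection ∘L (Matrix.toEuclideanLin X.transpose).toContinuousLinearMap
  have hD : ∀ v, D v = Uᗮ.starProjection (WithLp.toLp 2 (∑ i, v i • Es i ω)) := fun v => by
    have h1 : D v = Uᗮ.starProjection (WithLp.toLp 2 (X.transpose.mulVec v.ofLp)) := rfl
    rw [h1, transpose_dataMatrix_mulVec, WithLp.toLp_add, map_add]
    have h2 : Uᗮ.starProjection (WithLp.toLp 2 (A.mulVec (∑ i, v.ofLp i • Zs i ω))) = 0 := by
      rw [Submodule.starProjection_orthogonal_apply_eq_zero]
      exact ⟨WithLp.toLp 2 (∑ i, v.ofLp i • Zs i ω), rfl⟩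
    rw [h2, zero_add]
  set r := √τ
  have hr : r ^ 2 = τ := Real.sq_sqrt hτ.le
  have hr0 : 0 < r := Real.sqrt_pos.2 hτ
  have hs0 : 0 < s := by linarith
  -- `(7 / 10)² ≤ 1 / 2` and `8 ≤ 3²` give the bounds on the net. The mesh `1 / (16 s)` costs `3 /
  -- 8`, leaving `13 / 40`, whose square exceeds `1 / 16`.
  have hlow := le_norm_of_sphere_net D (ε := 1 / (16 * s)) (a := 7 / 10 * r) (c := 3 * s * r)
    (by rw [div_le_div_iff₀ (by positivity) (by norm_num)]; linarith) (by positivity) hnet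
    (fun v hv => by
      rw [hD]
      obtain ⟨h1, h2⟩ := hN v hv
      constructor
      · refine le_of_sq_le_sq ?_ (norm_nonneg _)
        nlinarith
      · refine le_of_sq_le_sq ?_ (by positivity)
        nlinarith [sq_nonneg (s * r)]) hu
  have e : 7 / 10 * r - 2 * (3 * s * r) * (1 / (16 * s)) = 13 / 40 * r := by
    field_simp; ring
  rw [e] at hlow
  have hcontr : ‖D u‖ ≤ ‖WithLp.toLp 2 (X.transpose.mulVec u.ofLp)‖ :=
    Submodule.norm_starProjection_apply_le _ _
  have h3 := pow_le_pow_left₀ (by positivity) (hlow.trans hcontr) 2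
  refine le_trans ?_ h3
  rw [mul_pow, hr]
  linarith

theorem finrank_range_toEuclideanLin_le {p K : ℕ} (A : Matrix (Fin p) (Fin K) ℝ) :
    Module.finrank ℝ (LinearMap.range (Matrix.toEuclideanLin A)) ≤ K := by
  simpa using LinearMap.finrank_range_le (Matrix.toEuclideanLin A)

end FactorRegression

/-! ### The main theorem -/

theorem mainTheorem4 (M : ℝ) (hM : 0 < M) :
    ∃ C c c' : ℝ, 0 < C ∧ 0 < c ∧ 0 < c' ∧
      ∀ (n p K : ℕ), K < n → n < p →
      ∀ (Ω₀ : Type*) [MeasurableSpace Ω₀] (P₀ : Measure Ω₀) [IsProbabilityMeasure P₀]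
        (Ω : Type*) [MeasurableSpace Ω] (P : Measure Ω) [IsProbabilityMeasure P]
        (Z : Ω₀ → Fin K → ℝ) (E : Ω₀ → Fin p → ℝ) (ε : Ω₀ → ℝ)
        (Zs : Fin n → Ω → Fin K → ℝ) (Es : Fin n → Ω → Fin p → ℝ) (εs : Fin n → Ω → ℝ)
        (A : Matrix (Fin p) (Fin K) ℝ) (β : Fin K → ℝ),
        FactorRegression.IsFactorModel P₀ P Z E ε Zs Es εs →
        A.rank = K →
        (FactorRegression.covMat P₀ Z).rank = K →
        FactorRegression.NoiseSubGaussian P₀ E M →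
        FactorRegression.FactorSubGaussian P₀ Z M →
        FactorRegression.ResponseNoiseSubGaussian P₀ ε M →
        C * (n : ℝ) < FactorRegression.effRank (FactorRegression.covMat P₀ E) →
        0 < (FactorRegression.covMat P₀ E).trace ∧
        ENNReal.ofReal (1 - c / (n : ℝ)) ≤
          P {ω | c' * (FactorRegression.covMat P₀ E).trace ≤
                FactorRegression.sigma n (FactorRegression.dataMatrix A Zs Es ω) ^ 2 ∧
              (FactorRegression.dataMatrix A Zs Es ω).mulVec
                  (FactorRegression.minNormEstimator (FactorRegression.dataMatrix A Zs Es ω)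
                    (FactorRegression.response β Zs εs ω)) =
                FactorRegression.response β Zs εs ω} := by
  set s : ℝ := 2 * M + 1 with hs
  have hs1 : 1 ≤ s := by linarith
  have hs0 : 0 < s := by linarith
  have hs4 : 1 ≤ s ^ 4 := one_le_pow₀ hs1
  have hL : 1 ≤ 1 + 2 / (1 / (16 * s)) := by
    have : 0 ≤ 2 / (1 / (16 * s)) := by positivity
    linarith
  set L : ℝ := 1 + 2 / (1 / (16 * s))
  have hlog : 0 ≤ Real.log L := Real.log_nonneg hL
  set κ : ℝ := 8192 * s ^ 4 * (Real.log L + 1) with hκ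
  have hκ2 : 2 ≤ κ := by nlinarith [mul_nonneg (by positivity : 0 ≤ s ^ 4) hlog]
  -- The `3` counts the three tails of the quadratic form; `1 / 32` combines `τ / 16 ≤ σ_n²` with
  -- `tr Σ_E ≤ 2 τ`.
  refine ⟨κ, 3, 1 / 32, by linarith, by norm_num, by norm_num, ?_⟩
  intro n p K hKn _ Ω₀ _ P₀ _ Ω _ P _ Z E ε Zs Es εs A β hmod _ _ hE _ _ hrank
  have hn : 0 < n := by omega
  have hn1 : (1 : ℝ) ≤ n := by exact_mod_cast hn
  set Q := FactorRegression.covMat P₀ E with hQdef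
  obtain ⟨htr, hop, hlt⟩ := FactorRegression.trace_pos_of_lt_effRank
    (by nlinarith : 1 ≤ κ * (n : ℝ)) hrank
  refine ⟨htr, ?_⟩
  set U := LinearMap.range (Matrix.toEuclideanLin A) with hU
  have hQ := FactorRegression.posSemidef_covMat hmod.memLp_E
  have hτ := FactorRegression.trace_sub_le_sum_orthogonal hQ U
  set τ := ∑ j, ‖Uᗮ.starProjection
    (WithLp.toLp 2 ((FactorRegression.matSqrt Q).mulVec (Pi.single j 1)))‖ ^ 2 with hτdef
  -- As `κ ≥ 2`, the discarded part is at most `n ‖Q‖ ≤ κ n ‖Q‖ / 2 < tr Q / 2`.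
  have hτ2 : Q.trace ≤ 2 * τ := by
    have hK : (Module.finrank ℝ U : ℝ) ≤ n := by
      exact_mod_cast (FactorRegression.finrank_range_toEuclideanLin_le A).trans hKn.le
    have h1 := mul_le_mul_of_nonneg_right hK hop.le
    have h2 := mul_le_mul_of_nonneg_right hκ2 (by positivity : 0 ≤ n * FactorRegression.opNorm Q)
    linarith
  have hτ0 : 0 < τ := by linarith
  obtain ⟨N, hN1, hNcard, hnet⟩ := FactorRegression.exists_sphere_net (EuclideanSpace ℝ (Fin n))
    (by positivity : 0 < 1 / (16 * s))
  rw [finrank_euclideanSpace_fin] at hNcard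
  let bad : EuclideanSpace ℝ (Fin n) → Set Ω := fun v =>
    {ω | ¬ (τ / 2 ≤ ‖Uᗮ.starProjection (WithLp.toLp 2 (∑ i, v i • Es i ω))‖ ^ 2 ∧
      ‖Uᗮ.starProjection (WithLp.toLp 2 (∑ i, v i • Es i ω))‖ ^ 2 ≤ 8 * s ^ 2 * τ)}
  have hbad : P (⋃ v ∈ N, bad v) ≤ ENNReal.ofReal (3 / n) := by
    refine (measure_biUnion_finset_le N bad).trans ((Finset.sum_le_sum fun v hv =>
      hmod.measure_noise_notMem_le hM hE hop Uᗮ.starProjection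
        (Submodule.norm_starProjection_apply_le _) hτdef.symm (v := v.ofLp) ?_).trans ?_)
    · rw [← FactorRegression.euclNorm_sq, FactorRegression.euclNorm, WithLp.toLp_ofLp, hN1 v hv,
        one_pow]
    · rw [Finset.sum_const, nsmul_eq_mul, ← ENNReal.ofReal_natCast, ← ENNReal.ofReal_ofNat,
        ← ENNReal.ofReal_mul (by norm_num), ← ENNReal.ofReal_mul (by positivity)]
      exact ENNReal.ofReal_le_ofReal (FactorRegression.card_mul_tail_le hn (by linarith) hs0 hop
        hNcard hκ (by linarith))
  set G : Set Ω := _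
  change _ ≤ P G
  -- Covering the whole space and using subadditivity avoids any measurability of the good event.
  have hcover : (Set.univ : Set Ω) ⊆ G ∪ ⋃ v ∈ N, bad v := fun ω _ => by
    by_cases hω : ω ∈ ⋃ v ∈ N, bad v
    · exact Or.inr hω
    · left
      have hω' : ∀ v ∈ N, _ := fun v hv => by
        have h1 : ω ∉ bad v := fun h => hω (Set.mem_biUnion hv h)
        exact not_not.1 h1
      obtain ⟨h1, h2⟩ := FactorRegression.le_sigma_sq_of_net hn A Zs Es ω hs1 hτ0 hnet hω'
      exact ⟨by linarith, h2 _⟩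
  have h1 : 1 ≤ P G + ENNReal.ofReal (3 / n) := by
    rw [← measure_univ (μ := P)]
    exact (measure_mono hcover).trans ((measure_union_le _ _).trans (by gcongr))
  rw [ENNReal.ofReal_sub _ (by positivity), ENNReal.ofReal_one]
  exact tsub_le_iff_right.2 h1
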